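/- For $d\ge 2$ let $\Gamma=PSL(d,\mathbb Z)$ (the quotient of $SL(d,\mathbb Z)$ by its centre) act by $[M]\circ S=MSM^{T}$ on the space $P^{(d)}$ of real symmetric positive definite $d\times d$ matrices of determinant $1$. Define on $P^{(d)}$ the invariant distance $$d_P(S_1,S_2)=\log\rho(S_1^{-1}S_2)+\log\rho(S_2^{-1}S_1),$$ where $\rho$ is the spectral radius (here, the largest eigenvalue). It is the unique $SL(d,\mathbb R)$-invariant function on $P^{(d)}\times P^{(d)}$ with $d_P(I,S)=\log\|S\|+\log\|S^{-1}\|$ for all $S$, where $\|\cdot\|$ is the Euclidean operator norm. Let $S_0\in P^{(d)}$ be any point whose stabiliser in $\Gamma$ is trivial, and let $d_R(\gamma_1,\gamma_2)=d_P(\gamma_1\circ S_0,\gamma_2\circ S_0)$ be the geometric distance on $\Gamma$. Let $\Sigma$ be any finite generating set of $\Gamma$, and let $d_W(\gamma_1,\gamma_2)$ be the word distance, that is, the least length of a word in $\Sigma\cup\Sigma^{-1}$ that represents $\gamma_1^{-1}\gamma_2$. Two functions $\delta,\delta'$ on $\Gamma\times\Gamma$ are Lipschitz equivalent if there are constants $c,C>0$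 with $c\,\delta(\gamma_1,\gamma_2)\le\delta'(\gamma_1,\gamma_2)\le C\,\delta(\gamma_1,\gamma_2)$ for all $\gamma_1,\gamma_2\in\Gamma$. Let also $e(S_1,S_2)=\log\|S_1^{-1}S_2\|+\log\|S_2^{-1}S_1\|$; this agrees with $d_P$ when $S_1=I$, but it is not invariant under the action. (1) Let $d=2$ and let $u\in\Gamma$ be the coset of $\begin{pmatrix}1&1\\0&1\end{pmatrix}$. Then $d_W(1,u^n)$ grows linearly: there are $a,b>0$ with $an\le d_W(1,u^n)\le bn$ for all integers $n\ge0$. On the other hand $d_R(1,u^n)=O(\log n)$ as $n\to\infty$, and $d_R$ is not Lipschitz equivalent to $d_W$. Likewise $e(S_0,u^n\circ S_0)=O(\log n)$, and $(\gamma_1,\gamma_2)\mapsto e(\gamma_1\circ S_0,\gamma_2\circ S_0)$ is not Lipschitz equivalent to $d_W$. (2) Let $d\ge3$. Then $d_R$ is Lipschitz equivalent to $d_W$. Moreover there are constants $c,C>0$ with $c\,e(S_0,\gamma\circ S_0)\le d_W(1,\gamma)\le C\,e(S_0,\gamma\circ S_0)$ for all $\gamma\in\Gamma$. -/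

import Mathlib

open scoped MatrixGroups

namespace PSLDistance

/-- Two distance functions are Lipschitz equivalent if each is bounded by a constant multiple of
the other. -/
def LipschitzEquiv {X : Type*} (d d' : X → X → ℝ) : Prop :=
  ∃ c C : ℝ, 0 < c ∧ 0 < C ∧ ∀ x y : X, c * d x y ≤ d' x y ∧ d' x y ≤ C * d x y

/-- The word length of `g`: the smallest length of a word in the elements of `S` and their inverses
that represents `g`. -/
noncomputable def wordLength {G : Type*} [Group G] (S : Set G) (g : G) : ℕ :=
  sInf {n : ℕ | ∃ w : List G, w.length = n ∧ (∀ x ∈ w, x ∈ S ∨ x⁻¹ ∈ S) ∧ w.prod = g}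

/-- The word distance with respect to `S`. -/
noncomputable def wordDist {G : Type*} [Group G] (S : Set G) (g h : G) : ℝ :=
  (wordLength S (g⁻¹ * h) : ℝ)

/-- The space of symmetric positive definite real `d × d` matrices of determinant `1`. -/
def PosDefOne (d : ℕ) : Type :=
  {S : Matrix (Fin d) (Fin d) ℝ // S.PosDef ∧ S.det = 1}

/-- `SL(d, ℝ)` acts on the space of positive definite matrices by `M ∘ S = M S Mᵀ`. -/
instance actionSLReal (d : ℕ) : MulAction SL(d, ℝ) (PosDefOne d) where
  smul M S := ⟨M.1 * S.1 * M.1.transpose, by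
    constructor
    · have h := S.2.1.mul_mul_conjTranspose_same (B := M.1)
        (Matrix.vecMul_injective_of_isUnit (by
          rw [Matrix.isUnit_iff_isUnit_det, M.2]; exact isUnit_one))
      simpa [Matrix.conjTranspose_eq_transpose_of_trivial] using h
    · rw [Matrix.det_mul, Matrix.det_mul, Matrix.det_transpose, M.2, S.2.2]; norm_num⟩
  one_smul S := Subtype.ext (by
    change (1 : SL(d, ℝ)).1 * S.1 * (1 : SL(d, ℝ)).1.transpose = S.1
    simp)
  mul_smul M N S := Subtype.ext (by
    change (M * N).1 * S.1 * (M * N).1.transpose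
      = M.1 * (N.1 * S.1 * N.1.transpose) * M.1.transpose
    simp [Matrix.transpose_mul, Matrix.mul_assoc])

/-- The action of `SL(d, ℤ)` as a homomorphism to permutations, through `SL(d, ℤ) → SL(d, ℝ)`. -/
noncomputable def permSLInt (d : ℕ) : SL(d, ℤ) →* Equiv.Perm (PosDefOne d) :=
  (MulAction.toPermHom SL(d, ℝ) (PosDefOne d)).comp
    (Matrix.SpecialLinearGroup.map (Int.castRingHom ℝ))

theorem permSLInt_apply (d : ℕ) (M : SL(d, ℤ)) (S : PosDefOne d) :
    (permSLInt d M S).1 = M.1.map (Int.cast : ℤ → ℝ) * S.1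
      * (M.1.map (Int.cast : ℤ → ℝ)).transpose := rfl

theorem center_le_ker_permSLInt (d : ℕ) :
    Subgroup.center SL(d, ℤ) ≤ (permSLInt d).ker := by
  intro M hM
  obtain ⟨r, hr, hM⟩ := Matrix.SpecialLinearGroup.mem_center_iff.1 hM
  rw [MonoidHom.mem_ker]
  ext S
  apply Subtype.ext
  rw [permSLInt_apply, ← hM]
  rcases Nat.eq_zero_or_pos d with rfl | hd
  · exact Subsingleton.elim _ _
  have hu : IsUnit r := IsUnit.of_pow_eq_one hr (by simpa using hd.ne')
  rcases Int.isUnit_iff.1 hu with rfl | rfl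
  · simp
  · have : (Matrix.scalar (Fin d) (-1 : ℤ)).map (Int.cast : ℤ → ℝ) = -1 := by
      ext i j
      by_cases h : i = j <;> simp [h]
    rw [this]
    simp

/-- `PSL(d, ℤ)` acts on the space of positive definite matrices by `[M] ∘ S = M S Mᵀ`. -/
noncomputable instance actionPSLInt (d : ℕ) : MulAction PSL(d, ℤ) (PosDefOne d) :=
  MulAction.compHom (PosDefOne d)
    (QuotientGroup.lift (Subgroup.center SL(d, ℤ)) (permSLInt d) (center_le_ker_permSLInt d))

theorem actionPSLInt_mk (d : ℕ) (M : SL(d, ℤ)) (S : PosDefOne d) :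
    ((M : PSL(d, ℤ)) • S).1 = M.1.map (Int.cast : ℤ → ℝ) * S.1
      * (M.1.map (Int.cast : ℤ → ℝ)).transpose := rfl

/-- The invariant distance `log ρ(S₁⁻¹S₂) + log ρ(S₂⁻¹S₁)`, with `ρ` the spectral radius. -/
noncomputable def invDist {d : ℕ} (S₁ S₂ : PosDefOne d) : ℝ :=
  Real.log (spectralRadius ℝ (S₁.1⁻¹ * S₂.1)).toReal
    + Real.log (spectralRadius ℝ (S₂.1⁻¹ * S₁.1)).toReal

/-- The expression `log ‖S₁⁻¹S₂‖ + log ‖S₂⁻¹S₁‖`, with the Euclidean operator norm. -/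
noncomputable def normDist {d : ℕ} (S₁ S₂ : PosDefOne d) : ℝ :=
  Real.log ‖Matrix.toEuclideanCLM (n := Fin d) (𝕜 := ℝ) (S₁.1⁻¹ * S₂.1)‖
    + Real.log ‖Matrix.toEuclideanCLM (n := Fin d) (𝕜 := ℝ) (S₂.1⁻¹ * S₁.1)‖

/-- The geometric distance on `PSL(d, ℤ)` with base point `S₀` that a function `D` of two points
of the space induces. -/
noncomputable def geomDist {d : ℕ} (D : PosDefOne d → PosDefOne d → ℝ) (S₀ : PosDefOne d)
    (γ₁ γ₂ : PSL(d, ℤ)) : ℝ :=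
  D (γ₁ • S₀) (γ₂ • S₀)

/-- The coset of the unipotent matrix with rows `(1, 1)` and `(0, 1)`. -/
def unipotent : PSL(2, ℤ) :=
  QuotientGroup.mk (⟨!![1, 1; 0, 1], by simp⟩ : SL(2, ℤ))

end PSLDistance

/-! Everything is compared with the logarithm of the Frobenius norm of a matrix `g` that represents
`γ`. The norm is submultiplicative, so `normDist` from the base point is at most a multiple of the
word length. A spectral radius is at most the operator norm, so `invDist ≤ normDist`. For `d ≥ 3` it
therefore suffices to bound the word length by `invDist`, and both distances are settled together.

The trace of `S₀⁻¹ (γ ∘ S₀)` controls the Frobenius norm, so log‖g‖ is at most a multiple of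
`invDist` plus a constant. Discreteness of the orbit and the trivial stabiliser absorb the constant.
What remains is that the word length is O(log‖g‖), from two facts. First, a transvection with
coefficient `n` has length O(log n): it lies in a copy of ℤ² acted on by SL(2, ℤ) inside SL(d, ℤ),
and a hyperbolic element there gives base expansions with boundedly many digits
(`exists_length_le_log`). Second, row reduction takes a number of Euclidean algorithms depending
only on `d`, and the logarithms of the quotients in each telescope (`log_tdiv_add_log_tmod_le`), so
the total cost stays logarithmic (`exists_length_le_logSize`).

For `d = 2` the entries of `u ^ n` are at most `n` for `n ≥ 1`, so both distances are O(log n). The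
word length is linear because the number of subtractive Euclidean steps on the second column changes
boundedly under each fixed left multiplication, is 0 at the identity and `n` at `u ^ n`. -/

namespace PSLDistance

/-! ### Word length and abstract length functions -/

section WordLength

variable {G : Type*} [Group G] {S : Set G}

theorem exists_word (hS : Subgroup.closure S = ⊤) (g : G) :
    ∃ w : List G, (∀ x ∈ w, x ∈ S ∨ x⁻¹ ∈ S) ∧ w.prod = g := by
  have hg : g ∈ (Subgroup.closure S).toSubmonoid := hS ▸ Subgroup.mem_top g
  rw [Subgroup.closure_toSubmonoid] at hg
  exact Submonoid.exists_list_of_mem_closure hg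

theorem wordLength_spec (hS : Subgroup.closure S = ⊤) (g : G) :
    ∃ w : List G, w.length = wordLength S g ∧ (∀ x ∈ w, x ∈ S ∨ x⁻¹ ∈ S) ∧ w.prod = g := by
  obtain ⟨w, hw, hg⟩ := exists_word hS g
  exact Nat.sInf_mem (s := {n : ℕ | ∃ w : List G, w.length = n ∧
    (∀ x ∈ w, x ∈ S ∨ x⁻¹ ∈ S) ∧ w.prod = g}) ⟨w.length, w, rfl, hw, hg⟩

theorem wordLength_prod_le {w : List G} (hw : ∀ x ∈ w, x ∈ S ∨ x⁻¹ ∈ S) :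
    wordLength S w.prod ≤ w.length :=
  Nat.sInf_le ⟨w, rfl, hw, rfl⟩

theorem wordLength_one : wordLength S (1 : G) = 0 :=
  Nat.le_zero.1 (wordLength_prod_le (S := S) (w := []) (by simp))

theorem wordLength_mul_le (hS : Subgroup.closure S = ⊤) (g h : G) :
    wordLength S (g * h) ≤ wordLength S g + wordLength S h := by
  obtain ⟨v, hv, hvS, rfl⟩ := wordLength_spec hS g
  obtain ⟨w, hw, hwS, rfl⟩ := wordLength_spec hS h
  rw [← hv, ← hw, ← List.prod_append, ← List.length_append]
  refine wordLength_prod_le fun x hx => ?_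
  rcases List.mem_append.1 hx with hx | hx
  exacts [hvS x hx, hwS x hx]

theorem wordLength_inv_le (hS : Subgroup.closure S = ⊤) (g : G) :
    wordLength S g⁻¹ ≤ wordLength S g := by
  obtain ⟨v, hv, hvS, rfl⟩ := wordLength_spec hS g
  rw [← hv, List.prod_inv_reverse]
  refine (wordLength_prod_le fun x hx => ?_).trans_eq (by simp)
  obtain ⟨y, hy, rfl⟩ : ∃ y ∈ v, y⁻¹ = x := by simpa using hx
  simpa [or_comm] using hvS y hy

theorem wordLength_inv (hS : Subgroup.closure S = ⊤) (g : G) :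
    wordLength S g⁻¹ = wordLength S g :=
  (wordLength_inv_le hS g).antisymm (by simpa using wordLength_inv_le hS g⁻¹)

theorem one_le_wordLength (hS : Subgroup.closure S = ⊤) {g : G} (hg : g ≠ 1) :
    1 ≤ wordLength S g := by
  obtain ⟨v, hv, -, rfl⟩ := wordLength_spec hS g
  rw [← hv, Nat.one_le_iff_ne_zero, Ne, List.length_eq_zero_iff]
  rintro rfl
  simp at hg

theorem wordLength_pow_le (hS : Subgroup.closure S = ⊤) (g : G) (n : ℕ) :
    wordLength S (g ^ n) ≤ n * wordLength S g := by
  induction n with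
  | zero => simp [wordLength_one]
  | succ n ih =>
    rw [pow_succ, add_one_mul]
    exact (wordLength_mul_le hS _ _).trans (by gcongr)

/-- A function that changes by a bounded amount under left multiplication by each fixed element
grows at most linearly in the word length. -/
theorem exists_le_mul_wordLength (hS : Subgroup.closure S = ⊤) (hfin : S.Finite) (f : G → ℝ)
    (hf : ∀ s, ∃ C : ℝ, ∀ g, f (s * g) ≤ f g + C) :
    ∃ C : ℝ, 0 ≤ C ∧ ∀ g, f g ≤ f 1 + C * wordLength S g := by
  choose c hc using hf
  obtain ⟨C, hC⟩ := ((hfin.union hfin.inv).image c).bddAbove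
  have key : ∀ w : List G, (∀ x ∈ w, x ∈ S ∨ x⁻¹ ∈ S) → f w.prod ≤ f 1 + max C 0 * w.length := by
    intro w
    induction w with
    | nil => simp
    | cons a w ih =>
      intro hw
      have ha : c a ≤ C := hC ⟨a, by simpa using hw a (by simp), rfl⟩
      have := ih fun x hx => hw x (by simp [hx])
      have := hc a w.prod
      have := le_max_left C 0
      rw [List.prod_cons, List.length_cons]
      push_cast
      linarith
  refine ⟨max C 0, le_max_right _ _, fun g => ?_⟩
  obtain ⟨v, hv, hvS, rfl⟩ := wordLength_spec hS g
  rw [← hv]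
  exact key v hvS

end WordLength

/-- A real-valued length function on a group. -/
structure IsLength {Γ : Type*} [Group Γ] (ℓ : Γ → ℝ) : Prop where
  one : ℓ 1 = 0
  mul : ∀ g h, ℓ (g * h) ≤ ℓ g + ℓ h
  inv : ∀ g, ℓ g⁻¹ = ℓ g

namespace IsLength

variable {Γ : Type*} [Group Γ] {ℓ : Γ → ℝ}

theorem nonneg (h : IsLength ℓ) (g : Γ) : 0 ≤ ℓ g := by
  have := h.mul g g⁻¹
  rw [mul_inv_cancel, h.one, h.inv] at this
  linarith

theorem pow_le (h : IsLength ℓ) (g : Γ) (n : ℕ) : ℓ (g ^ n) ≤ n * ℓ g := by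
  induction n with
  | zero => simp [h.one]
  | succ n ih =>
    rw [pow_succ]
    push_cast
    linarith [h.mul (g ^ n) g]

end IsLength

/-- Ensures that about log₂ `m` Fibonacci digits suffice to represent `m`. -/
theorem two_pow_le_fib (k : ℕ) : 2 ^ k ≤ Nat.fib (2 * k + 2) := by
  induction k with
  | zero => simp
  | succ k ih =>
    have h1 : Nat.fib (2 * (k + 1) + 2) = Nat.fib (2 * k + 2) + Nat.fib (2 * k + 3) :=
      Nat.fib_add_two
    have h2 : Nat.fib (2 * k + 2) ≤ Nat.fib (2 * k + 3) := Nat.fib_le_fib_succ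
    rw [pow_succ]
    omega

/-! ### Exponential distortion inside ℤ² ⋊ SL(2, ℤ) -/

section Distortion

variable {Γ : Type*} [Group Γ] {x y : Γ} {V : ℤ → ℤ → Γ}

/-- Conjugation by `x * y` acts on the pairs `(a, b)` by the hyperbolic matrix with rows (2, 1), (1,
1), whose powers have Fibonacci entries. -/
theorem conj_hyperbolic_pow
    (hx : ∀ a b, x * V a b = V (a + b) b * x) (hy : ∀ a b, y * V a b = V a (a + b) * y)
    (k n : ℕ) :
    (x * y) ^ k * V n 0 = V (n * Nat.fib (2 * k + 1) : ℕ) (n * Nat.fib (2 * k) : ℕ) * (x * y) ^ k := by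
  induction k with
  | zero => simp
  | succ k ih =>
    have h1 : Nat.fib (2 * (k + 1)) = Nat.fib (2 * k) + Nat.fib (2 * k + 1) := Nat.fib_add_two
    have h2 : Nat.fib (2 * (k + 1) + 1) = Nat.fib (2 * k + 1) + Nat.fib (2 * (k + 1)) :=
      Nat.fib_add_two
    rw [pow_succ', mul_assoc, ih, ← mul_assoc, mul_assoc x, hy, ← mul_assoc x, hx, h2, h1]
    simp only [mul_assoc]
    congr 1
    congr 1 <;> push_cast <;> ring

/-- The Horner scheme for expansions in even-index Fibonacci numbers. -/
theorem exists_length_fibonacci_le {ℓ : Γ → ℝ} (hℓ : IsLength ℓ)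
    (hV : ∀ a b c d, V a b * V c d = V (a + c) (b + d))
    (hx : ∀ a b, x * V a b = V (a + b) b * x) (hy : ∀ a b, y * V a b = V a (a + b) * y)
    (h0 : V 0 0 = 1) (k : ℕ) (m : ℕ) (hm : m < Nat.fib (2 * k + 2)) :
    ∃ a : ℤ, ℓ (V a m * (x * y) ^ k) ≤ k * (ℓ (x * y) + 2 * ℓ (V 1 0)) := by
  induction k generalizing m with
  | zero =>
    obtain rfl : m = 0 := by simpa using hm
    exact ⟨0, by simp [h0, hℓ.one]⟩
  | succ k ih =>
    set b := Nat.fib (2 * k + 2) with hb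
    have hbpos : 0 < b := Nat.fib_pos.2 (by omega)
    -- F(2k+4) = 2F(2k+2) + F(2k+1) ≤ 3F(2k+2), so the leading digit is 0, 1 or 2.
    have hlt : m / b < 3 := by
      rw [Nat.div_lt_iff_lt_mul hbpos]
      have h1 : Nat.fib (2 * (k + 1) + 2) = Nat.fib (2 * k + 2) + Nat.fib (2 * k + 3) :=
        Nat.fib_add_two
      have h2 : Nat.fib (2 * k + 3) = Nat.fib (2 * k + 1) + Nat.fib (2 * k + 2) :=
        Nat.fib_add_two
      have h3 : Nat.fib (2 * k + 1) ≤ Nat.fib (2 * k + 2) := Nat.fib_le_fib_succ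
      omega
    obtain ⟨a, ha⟩ := ih (m % b) (Nat.mod_lt _ hbpos)
    -- Only the second coordinate is prescribed; the first is whatever the digits produce.
    refine ⟨a + (m / b * Nat.fib (2 * (k + 1) + 1) : ℕ), ?_⟩
    have hdecomp : V (a + (m / b * Nat.fib (2 * (k + 1) + 1) : ℕ)) m * (x * y) ^ (k + 1)
        = V a (m % b : ℕ) * (x * y) ^ k * ((x * y) * V (m / b : ℕ) 0) := by
      rw [← mul_assoc, mul_assoc (V a _), ← pow_succ, mul_assoc, conj_hyperbolic_pow hx hy,
        ← mul_assoc, hV]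
      congr 2
      rw [show Nat.fib (2 * (k + 1)) = b from rfl]
      exact_mod_cast (Nat.mod_add_div' m b).symm
    have hε : ℓ (V (m / b : ℕ) 0) ≤ 2 * ℓ (V 1 0) := by
      have hnn := hℓ.nonneg (V 1 0)
      have h2 : V 2 0 = V 1 0 * V 1 0 := by rw [hV]; norm_num
      have h2' := hℓ.mul (V 1 0) (V 1 0)
      rw [← h2] at h2'
      generalize m / b = e at hlt
      interval_cases e
      · simp [h0, hℓ.one, hnn]
      · push_cast; linarith
      · push_cast; linarith
    rw [hdecomp]
    have h1 := hℓ.mul (V a (m % b : ℕ) * (x * y) ^ k) ((x * y) * V (m / b : ℕ) 0)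
    have h2 := hℓ.mul (x * y) (V (m / b : ℕ) 0)
    push_cast at *
    linarith

/-- A cyclic subgroup in a copy of `ℤ²` that is normalised by `SL(2, ℤ)` is exponentially
distorted. -/
theorem exists_length_le_log {ℓ : Γ → ℝ} (hℓ : IsLength ℓ)
    (hV : ∀ a b c d, V a b * V c d = V (a + c) (b + d))
    (hx : ∀ a b, x * V a b = V (a + b) b * x) (hy : ∀ a b, y * V a b = V a (a + b) * y) :
    ∃ K : ℝ, 0 ≤ K ∧ ∀ n : ℤ, ℓ (V n 0) ≤ K * Real.log (1 + |(n : ℝ)|) := by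
  have h0 : V 0 0 = 1 := by simpa using hV 0 0 0 0
  have hA := hℓ.nonneg (x * y)
  have hx0 := hℓ.nonneg x
  have hV0 := hℓ.nonneg (V 1 0)
  -- Cost per digit, with one extra `ℓ (x * y)` for cancelling the trailing power of `x * y`.
  set c := 2 * ℓ (x * y) + 2 * ℓ (V 1 0) with hc
  have hlog2 : 0 < Real.log 2 := Real.log_pos (by norm_num)
  have hnat : ∀ m : ℕ, ℓ (V m 0) ≤
      ((2 * ℓ x + 2 * c) / Real.log 2 + 2 * c / Real.log 2) * Real.log (1 + m) := by
    intro m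
    rcases Nat.eq_zero_or_pos m with rfl | hm
    · simp [h0, hℓ.one]
    set k := Nat.log 2 m + 1 with hk
    obtain ⟨a, ha⟩ := exists_length_fibonacci_le hℓ hV hx hy h0 k m
      ((Nat.lt_pow_succ_log_self (by norm_num) m).trans_le (two_pow_le_fib k))
    have hW : ℓ (V a m) ≤ k * c := by
      have h1 := hℓ.mul (V a m * (x * y) ^ k) ((x * y) ^ k)⁻¹
      rw [mul_inv_cancel_right, hℓ.inv] at h1
      have h2 := hℓ.pow_le (x * y) k
      rw [hc]
      linarith
    -- The commutator with `x` sees only the second coordinate, so the uncontrolled `a` drops out.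
    have hcomm : V m 0 = x * V a m * x⁻¹ * (V a m)⁻¹ := by
      rw [hx, mul_inv_cancel_right, eq_mul_inv_iff_mul_eq, hV]
      congr 1 <;> ring
    have hle : ℓ (V m 0) ≤ 2 * ℓ x + 2 * (k * c) := by
      rw [hcomm]
      have h1 := hℓ.mul (x * V a m * x⁻¹) (V a m)⁻¹
      have h2 := hℓ.mul (x * V a m) x⁻¹
      have h3 := hℓ.mul x (V a m)
      rw [hℓ.inv] at h1 h2
      linarith
    have hm1 : (1 : ℝ) ≤ m := by exact_mod_cast hm
    have hlog1 : Real.log 2 ≤ Real.log (1 + m) := Real.log_le_log (by norm_num) (by linarith)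
    have hklog : (Nat.log 2 m : ℝ) * Real.log 2 ≤ Real.log (1 + m) := by
      rw [← Real.log_pow]
      apply Real.log_le_log (by positivity)
      have : ((2 ^ Nat.log 2 m : ℕ) : ℝ) ≤ m := by exact_mod_cast Nat.pow_log_le_self 2 hm.ne'
      push_cast at this
      linarith
    refine hle.trans ?_
    have hcpos : 0 ≤ c := by positivity
    have e1 : (2 * ℓ x + 2 * c) ≤ (2 * ℓ x + 2 * c) / Real.log 2 * Real.log (1 + m) := by
      rw [div_mul_eq_mul_div, le_div_iff₀ hlog2]
      gcongr
    have e2 : 2 * c * Nat.log 2 m ≤ 2 * c / Real.log 2 * Real.log (1 + m) := by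
      rw [div_mul_eq_mul_div, le_div_iff₀ hlog2, mul_assoc]
      gcongr
    rw [add_mul, hk]
    push_cast
    linarith
  refine ⟨(2 * ℓ x + 2 * c) / Real.log 2 + 2 * c / Real.log 2, by positivity, fun n => ?_⟩
  obtain ⟨m, rfl | rfl⟩ := n.eq_nat_or_neg
  · simpa using hnat m
  · have : V (-(m : ℤ)) 0 = (V m 0)⁻¹ := by
      rw [eq_inv_iff_mul_eq_one, hV]
      simpa using h0
    rw [this, hℓ.inv]
    simpa using hnat m

end Distortion

open Matrix

/-! ### Frobenius norm and logarithmic size of integer matrices -/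

section Frobenius

variable {d : ℕ}

/-- The square of the Frobenius norm. -/
def frobSq (M : Matrix (Fin d) (Fin d) ℝ) : ℝ := ∑ i, ∑ j, M i j ^ 2

theorem frobSq_nonneg (M : Matrix (Fin d) (Fin d) ℝ) : 0 ≤ frobSq M := by
  unfold frobSq; positivity

theorem sq_entry_le_frobSq (M : Matrix (Fin d) (Fin d) ℝ) (i j : Fin d) : M i j ^ 2 ≤ frobSq M :=
  (Finset.single_le_sum (f := fun j => M i j ^ 2) (fun _ _ => sq_nonneg _)
    (Finset.mem_univ j)).trans
  (Finset.single_le_sum (f := fun i => ∑ j, M i j ^ 2)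
    (fun _ _ => Finset.sum_nonneg fun _ _ => sq_nonneg _) (Finset.mem_univ i))

theorem frobSq_mul_le (A B : Matrix (Fin d) (Fin d) ℝ) :
    frobSq (A * B) ≤ frobSq A * frobSq B := by
  unfold frobSq
  have h : ∀ i j, (A * B) i j ^ 2 ≤ (∑ k, A i k ^ 2) * ∑ k, B k j ^ 2 := fun i j => by
    rw [Matrix.mul_apply]
    exact Finset.sum_mul_sq_le_sq_mul_sq _ _ _
  calc _ ≤ ∑ i, ∑ j, (∑ k, A i k ^ 2) * ∑ k, B k j ^ 2 := by gcongr; exact h _ _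
    _ = _ := by
      rw [Finset.sum_mul]
      simp_rw [← Finset.mul_sum]
      rw [Finset.sum_comm (f := fun i j => B i j ^ 2)]

theorem frobSq_transpose (A : Matrix (Fin d) (Fin d) ℝ) : frobSq Aᵀ = frobSq A :=
  Finset.sum_comm

theorem frobSq_eq_trace (A : Matrix (Fin d) (Fin d) ℝ) : frobSq A = (A * Aᵀ).trace := by
  simp [frobSq, Matrix.trace, Matrix.mul_apply, sq]

/-- The integer matrix `g` as a real matrix. -/
def toReal (g : SL(d, ℤ)) : Matrix (Fin d) (Fin d) ℝ := g.1.map (Int.cast : ℤ → ℝ)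

theorem toReal_mul (g h : SL(d, ℤ)) : toReal (g * h) = toReal g * toReal h :=
  Matrix.map_mul (f := Int.castRingHom ℝ)

theorem toReal_one : toReal (1 : SL(d, ℤ)) = 1 := by
  simp [toReal]

theorem det_toReal (g : SL(d, ℤ)) : (toReal g).det = 1 := by
  have := (Int.castRingHom ℝ).map_det g.1
  rw [g.2] at this
  simpa [toReal, RingHom.mapMatrix_apply] using this.symm

theorem toReal_inv (g : SL(d, ℤ)) : toReal g⁻¹ = (toReal g)⁻¹ := by
  refine (Matrix.inv_eq_right_inv ?_).symm
  rw [← toReal_mul, mul_inv_cancel, toReal_one]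

theorem one_le_frobSq [NeZero d] (g : SL(d, ℤ)) : 1 ≤ frobSq (toReal g) := by
  obtain ⟨i, j, hij⟩ : ∃ i j, g.1 i j ≠ 0 := by
    by_contra! h
    have h0 : g.1 = 0 := by ext i j; exact h i j
    have h1 := g.2
    rw [h0, Matrix.det_zero] at h1
    exact zero_ne_one h1
  refine le_trans ?_ (sq_entry_le_frobSq (toReal g) i j)
  have : (1 : ℤ) ≤ g.1 i j ^ 2 := by have := sq_pos_of_ne_zero hij; omega
  simpa [toReal] using (show (1 : ℝ) ≤ (g.1 i j : ℝ) ^ 2 by exact_mod_cast this)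

theorem abs_entry_le_frobSq (g : SL(d, ℤ)) (i j : Fin d) : |(g.1 i j : ℝ)| ≤ frobSq (toReal g) := by
  refine le_trans ?_ (sq_entry_le_frobSq (toReal g) i j)
  have : |g.1 i j| ≤ g.1 i j ^ 2 := by
    rw [← sq_abs]
    rcases (abs_nonneg (g.1 i j)).eq_or_lt with h | h
    · simp [← h]
    · nlinarith
  simpa [toReal] using (show |(g.1 i j : ℝ)| ≤ (g.1 i j : ℝ) ^ 2 by exact_mod_cast this)

theorem finite_setOf_frobSq_le (R : ℝ) : {g : SL(d, ℤ) | frobSq (toReal g) ≤ R}.Finite := by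
  have h : {M : Matrix (Fin d) (Fin d) ℤ | ∀ i j, M i j ∈ Set.Icc (-⌈R⌉) ⌈R⌉}.Finite := by
    have := Set.Finite.pi' (ι := Fin d) fun _ =>
      Set.Finite.pi' (ι := Fin d) fun _ => Set.finite_Icc (-⌈R⌉) ⌈R⌉
    exact this
  refine (h.preimage (f := Subtype.val) Subtype.val_injective.injOn).subset fun g hg i j => ?_
  have h1 := ((abs_entry_le_frobSq g i j).trans hg).trans (Int.le_ceil R)
  rw [Set.mem_Icc, ← abs_le]
  exact_mod_cast h1

/-- One plus the logarithm of the square of the Frobenius norm. -/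
noncomputable def logSize (g : SL(d, ℤ)) : ℝ := 1 + Real.log (frobSq (toReal g))

/-- The summand 1 in `logSize` serves this: additive constants can be absorbed into multiples of
`logSize`. -/
theorem one_le_logSize [NeZero d] (g : SL(d, ℤ)) : 1 ≤ logSize g := by
  have := Real.log_nonneg (one_le_frobSq g)
  unfold logSize; linarith

theorem logSize_mul_le [NeZero d] (g h : SL(d, ℤ)) : logSize (g * h) ≤ logSize g + logSize h := by
  have hg := one_le_frobSq g
  have hh := one_le_frobSq h
  have : Real.log (frobSq (toReal (g * h)))
      ≤ Real.log (frobSq (toReal g)) + Real.log (frobSq (toReal h)) := by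
    rw [← Real.log_mul (by positivity) (by positivity), toReal_mul]
    refine Real.log_le_log ?_ (frobSq_mul_le _ _)
    rw [← toReal_mul]
    linarith [one_le_frobSq (g * h)]
  unfold logSize; linarith

theorem log_entry_le_logSize [NeZero d] (g : SL(d, ℤ)) (i j : Fin d) :
    Real.log (1 + |(g.1 i j : ℝ)|) ≤ logSize g := by
  have h1 := one_le_frobSq g
  have h2 := abs_entry_le_frobSq g i j
  calc Real.log (1 + |(g.1 i j : ℝ)|) ≤ Real.log (2 * frobSq (toReal g)) :=
        Real.log_le_log (by positivity) (by linarith)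
    _ = Real.log 2 + Real.log (frobSq (toReal g)) := Real.log_mul (by norm_num) (by positivity)
    _ ≤ _ := by unfold logSize; linarith [Real.log_two_lt_d9]

end Frobenius

/-! ### Transvections have logarithmic length when `d ≥ 3` -/

section Transvections

variable {d : ℕ}

theorem transvection_mulVec_apply {i j : Fin d} (hij : i ≠ j) (b : ℤ) (v : Fin d → ℤ) (k : Fin d) :
    ((SpecialLinearGroup.transvection hij b).1 *ᵥ v) k = v k + if k = i then b * v j else 0 := by
  rw [SpecialLinearGroup.transvection_coe, Matrix.add_mulVec, Matrix.one_mulVec, Pi.add_apply,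
    Matrix.single_mulVec]
  by_cases h : k = i
  · subst h; simp
  · simp [h]

theorem specialLinearGroup_ext_mulVec {g h : SL(d, ℤ)} (H : ∀ v k, (g.1 *ᵥ v) k = (h.1 *ᵥ v) k) :
    g = h := by
  refine Subtype.ext (Matrix.mulVec_injective ?_)
  ext v k
  exact H v k

theorem coe_mul_mulVec (g h : SL(d, ℤ)) (v : Fin d → ℤ) :
    (g * h).1 *ᵥ v = g.1 *ᵥ (h.1 *ᵥ v) := by
  rw [Matrix.mulVec_mulVec]; rfl

/-- A third index `j` exists. The transvections that mix `i` and `j` act on the ℤ² formed by the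
`(i, k)` and `(j, k)` transvections as the elementary matrices of SL(2, ℤ), so the distortion lemma
applies. -/
theorem exists_transvection_length_le {ℓ : SL(d, ℤ) → ℝ} (hℓ : IsLength ℓ) (hd : 3 ≤ d) :
    ∃ K : ℝ, 0 ≤ K ∧ ∀ (i j : Fin d) (hij : i ≠ j) (n : ℤ),
      ℓ (SpecialLinearGroup.transvection hij n) ≤ K * Real.log (1 + |(n : ℝ)|) := by
  have key : ∀ i k : Fin d, ∃ K : ℝ, 0 ≤ K ∧ ∀ (hik : i ≠ k) (n : ℤ),
      ℓ (SpecialLinearGroup.transvection hik n) ≤ K * Real.log (1 + |(n : ℝ)|) := by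
    intro i k
    by_cases hik : i = k
    · exact ⟨0, le_rfl, fun h => absurd hik h⟩
    obtain ⟨j, hji, hjk⟩ : ∃ j, j ≠ i ∧ j ≠ k := by
      have : ({i, k} : Finset (Fin d)).card < (Finset.univ : Finset (Fin d)).card := by
        rw [Finset.card_univ, Fintype.card_fin]
        exact (Finset.card_le_two).trans_lt (by omega)
      obtain ⟨j, -, hj⟩ := Finset.exists_mem_notMem_of_card_lt_card this
      exact ⟨j, by simpa [not_or] using hj⟩
    obtain ⟨K, hK, H⟩ := exists_length_le_log hℓ
      (x := SpecialLinearGroup.transvection hji.symm 1)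
      (y := SpecialLinearGroup.transvection hji 1)
      (V := fun a b => SpecialLinearGroup.transvection hik a * SpecialLinearGroup.transvection hjk b)
      (fun a b c e => specialLinearGroup_ext_mulVec fun v l => by
        simp only [coe_mul_mulVec, transvection_mulVec_apply]
        grind)
      (fun a b => specialLinearGroup_ext_mulVec fun v l => by
        simp only [coe_mul_mulVec, transvection_mulVec_apply]
        grind)
      (fun a b => specialLinearGroup_ext_mulVec fun v l => by
        simp only [coe_mul_mulVec, transvection_mulVec_apply]
        grind)
    refine ⟨K, hK, fun _ n => ?_⟩
    simpa [SpecialLinearGroup.transvection_coeff_zero] using H n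
  choose K hK H using key
  refine ⟨∑ i, ∑ k, K i k, Finset.sum_nonneg fun _ _ => Finset.sum_nonneg fun _ _ => hK _ _,
    fun i j hij n => (H i j hij n).trans ?_⟩
  have : K i j ≤ ∑ i, ∑ k, K i k :=
    (Finset.single_le_sum (f := fun j => K i j) (fun _ _ => hK _ _) (Finset.mem_univ j)).trans
    (Finset.single_le_sum (f := fun i => ∑ j, K i j)
      (fun _ _ => Finset.sum_nonneg fun _ _ => hK _ _) (Finset.mem_univ i))
  gcongr
  exact Real.log_nonneg (by simp)

end Transvections

/-! ### Euclid's algorithm at logarithmic cost -/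

section Euclid

variable {d : ℕ}

/-- `h` only mixes the coordinates `i` and `j`. -/
structure MixesOnly (i j : Fin d) (h : SL(d, ℤ)) : Prop where
  apply_of_ne : ∀ w k, k ≠ i → k ≠ j → (h.1 *ᵥ w) k = w k
  fixes : ∀ w, w i = 0 → w j = 0 → h.1 *ᵥ w = w

theorem MixesOnly.symm {i j : Fin d} {h : SL(d, ℤ)} (H : MixesOnly i j h) : MixesOnly j i h :=
  ⟨fun w k hi hj => H.apply_of_ne w k hj hi, fun w hi hj => H.fixes w hj hi⟩

theorem MixesOnly.one (i j : Fin d) : MixesOnly i j 1 :=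
  ⟨fun w k _ _ => by simp, fun w _ _ => by simp⟩

theorem MixesOnly.mul {i j : Fin d} {g h : SL(d, ℤ)} (hg : MixesOnly i j g)
    (hh : MixesOnly i j h) : MixesOnly i j (g * h) := by
  refine ⟨fun w k hi hj => ?_, fun w hi hj => ?_⟩
  · rw [coe_mul_mulVec, hg.apply_of_ne _ k hi hj, hh.apply_of_ne _ k hi hj]
  · rw [coe_mul_mulVec, hh.fixes w hi hj, hg.fixes w hi hj]

theorem mixesOnly_transvection {i j : Fin d} (hij : i ≠ j) (b : ℤ) :
    MixesOnly i j (SpecialLinearGroup.transvection hij b) := by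
  refine ⟨fun w k hi hj => ?_, fun w hi hj => ?_⟩
  · simp [transvection_mulVec_apply, hi]
  · ext k
    simp [transvection_mulVec_apply, hj]

/-- With quotient `q` and remainder `r`, |r| + 1 ≤ |b| gives (1 + |q|)(1 + |r|) ≤ 1 + |a|. Thus each
division step is paid for by the drop in the sum of the logarithms of the two coordinates, and no
factor counting the steps appears. -/
theorem log_tdiv_add_log_tmod_le (a b : ℤ) (hb : b ≠ 0) :
    Real.log (1 + |(a.tdiv b : ℝ)|) + Real.log (1 + |(a.tmod b : ℝ)|)
      ≤ Real.log (1 + |(a : ℝ)|) := by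
  rw [← Real.log_mul (by positivity) (by positivity)]
  apply Real.log_le_log (by positivity)
  have h1 : a.natAbs = b.natAbs * (a.tdiv b).natAbs + (a.tmod b).natAbs := by
    rw [Int.natAbs_tdiv, Int.natAbs_tmod]
    exact (Nat.div_add_mod _ _).symm
  have h2 : (a.tmod b).natAbs < b.natAbs := by
    rw [Int.natAbs_tmod]
    exact Nat.mod_lt _ (Int.natAbs_pos.2 hb)
  have h3 : (1 + (a.tdiv b).natAbs) * (1 + (a.tmod b).natAbs) ≤ 1 + a.natAbs := by
    rw [h1]
    linarith [Nat.mul_le_mul_right (a.tdiv b).natAbs (Nat.succ_le_of_lt h2)]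
  have h4 : ((1 + (a.tdiv b).natAbs) * (1 + (a.tmod b).natAbs) : ℝ) ≤ 1 + (a.natAbs : ℝ) := by
    exact_mod_cast h3
  simpa only [Nat.cast_natAbs, Int.cast_abs] using h4

variable {ℓ : SL(d, ℤ) → ℝ}

/-- Euclid's algorithm with transvections annihilates one of two coordinates. -/
theorem exists_mixesOnly_euclid (hℓ : IsLength ℓ) {K : ℝ} (hK0 : 0 ≤ K)
    (hK : ∀ (i j : Fin d) (hij : i ≠ j) (n : ℤ),
      ℓ (SpecialLinearGroup.transvection hij n) ≤ K * Real.log (1 + |(n : ℝ)|))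
    (n : ℕ) (i j : Fin d) (hij : i ≠ j) (v : Fin d → ℤ) (hn : (v j).natAbs = n) :
    ∃ h : SL(d, ℤ), MixesOnly i j h ∧ ((h.1 *ᵥ v) i = 0 ∨ (h.1 *ᵥ v) j = 0) ∧
      ℓ h ≤ K * (Real.log (1 + |(v i : ℝ)|) + Real.log (1 + |(v j : ℝ)|)) := by
  induction n using Nat.strong_induction_on generalizing i j v with
  | _ n ih =>
    rcases eq_or_ne (v j) 0 with hj | hj
    · refine ⟨1, MixesOnly.one i j, Or.inr (by simp [hj]), ?_⟩
      rw [hℓ.one]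
      have h1 : 0 ≤ Real.log (1 + |(v i : ℝ)|) := Real.log_nonneg (by simp)
      have h2 : 0 ≤ Real.log (1 + |(v j : ℝ)|) := Real.log_nonneg (by simp)
      positivity
    set t := SpecialLinearGroup.transvection hij (-(v i).tdiv (v j)) with ht
    have hi' : (t.1 *ᵥ v) i = (v i).tmod (v j) := by
      rw [ht, transvection_mulVec_apply, if_pos rfl, Int.tmod_def]
      ring
    have hj' : (t.1 *ᵥ v) j = v j := by
      rw [ht, transvection_mulVec_apply, if_neg hij.symm, add_zero]
    -- The coordinates swap roles: the remainder at `i` is the next divisor.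
    obtain ⟨h, hmix, hzero, hle⟩ := ih ((t.1 *ᵥ v) i).natAbs (by
      rw [hi', ← hn, Int.natAbs_tmod]
      exact Nat.mod_lt _ (Int.natAbs_pos.2 hj)) j i hij.symm (t.1 *ᵥ v) rfl
    refine ⟨h * t, hmix.symm.mul (mixesOnly_transvection hij _), ?_, ?_⟩
    · rw [coe_mul_mulVec]
      exact hzero.symm
    · have h1 := hℓ.mul h t
      have h2 := hK i j hij (-(v i).tdiv (v j))
      have h3 := mul_le_mul_of_nonneg_left (log_tdiv_add_log_tmod_le (v i) (v j) hj) hK0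
      rw [hi', hj'] at hle
      rw [Int.cast_neg, abs_neg] at h2
      linarith

/-- The second of two coordinates can be annihilated at logarithmic cost. -/
theorem exists_mixesOnly_apply_eq_zero (hℓ : IsLength ℓ) {K : ℝ} (hK0 : 0 ≤ K)
    (hK : ∀ (i j : Fin d) (hij : i ≠ j) (n : ℤ),
      ℓ (SpecialLinearGroup.transvection hij n) ≤ K * Real.log (1 + |(n : ℝ)|))
    (i j : Fin d) (hij : i ≠ j) (v : Fin d → ℤ) :
    ∃ h : SL(d, ℤ), MixesOnly i j h ∧ (h.1 *ᵥ v) j = 0 ∧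
      ℓ h ≤ K * (Real.log (1 + |(v i : ℝ)|) + Real.log (1 + |(v j : ℝ)|) + 2) := by
  obtain ⟨h, hmix, hzero, hle⟩ := exists_mixesOnly_euclid hℓ hK0 hK _ i j hij v rfl
  rcases hzero with h0 | h0
  -- If the algorithm ends at (0, c), move on to (c, c) and then (c, 0); each of the two moves costs
  -- at most `K * log 2 ≤ K`.
  · set s := SpecialLinearGroup.transvection hij.symm (-1 : ℤ) with hs
    set t := SpecialLinearGroup.transvection hij (1 : ℤ) with ht
    refine ⟨s * (t * h), (mixesOnly_transvection hij.symm _).symm.mul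
      ((mixesOnly_transvection hij _).mul hmix), ?_, ?_⟩
    · rw [coe_mul_mulVec, coe_mul_mulVec, hs, ht, transvection_mulVec_apply,
        transvection_mulVec_apply, transvection_mulVec_apply, h0]
      simp [hij.symm]
    · have h1 := hℓ.mul s (t * h)
      have h2 := hℓ.mul t h
      have hlog : Real.log (1 + 1) ≤ 1 := by norm_num; linarith [Real.log_two_lt_d9]
      have h3 : ℓ s ≤ K * 1 := (hK j i hij.symm (-1)).trans
        (mul_le_mul_of_nonneg_left (by simpa using hlog) hK0)
      have h4 : ℓ t ≤ K * 1 := (hK i j hij 1).trans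
        (mul_le_mul_of_nonneg_left (by simpa using hlog) hK0)
      linarith
  · exact ⟨h, hmix, h0, hle.trans (mul_le_mul_of_nonneg_left (by linarith) hK0)⟩

end Euclid

/-! ### Row reduction to the identity at logarithmic cost -/

section Reduction

variable {d : ℕ}

/-- Every matrix with property `R` can be brought to property `R'` by a left multiplication whose
length is at most a multiple of `logSize`. -/
def LogReduces (ℓ : SL(d, ℤ) → ℝ) (R R' : SL(d, ℤ) → Prop) : Prop :=
  ∃ K : ℝ, 0 ≤ K ∧ ∀ g, R g → ∃ h, ℓ h ≤ K * logSize g ∧ R' (h * g)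

variable {ℓ : SL(d, ℤ) → ℝ} {R R' R'' : SL(d, ℤ) → Prop}

theorem LogReduces.of_imp (hℓ : IsLength ℓ) (h : ∀ g, R g → R' g) : LogReduces ℓ R R' :=
  ⟨0, le_rfl, fun g hg => ⟨1, by simp [hℓ.one], by simpa using h g hg⟩⟩

/-- By `hL`, a multiplier of length O(`logSize g`) itself has `logSize` of that order, so the matrix
after the first reduction is still of logarithmic size O(`logSize g`). -/
theorem LogReduces.trans [NeZero d] (hℓ : IsLength ℓ)
    (hL : ∃ C : ℝ, 0 ≤ C ∧ ∀ g, logSize g ≤ C * (ℓ g + 1))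
    (h₁ : LogReduces ℓ R R') (h₂ : LogReduces ℓ R' R'') : LogReduces ℓ R R'' := by
  obtain ⟨C, hC0, hC⟩ := hL
  obtain ⟨K₁, hK₁, H₁⟩ := h₁
  obtain ⟨K₂, hK₂, H₂⟩ := h₂
  refine ⟨K₂ * (C * (K₁ + 1) + 1) + K₁, by positivity, fun g hg => ?_⟩
  obtain ⟨a, ha, ha'⟩ := H₁ g hg
  obtain ⟨b, hb, hb'⟩ := H₂ _ ha'
  refine ⟨b * a, ?_, by rwa [mul_assoc]⟩
  have h1 := one_le_logSize g
  have h2 : logSize a ≤ C * (K₁ * logSize g + logSize g) := (hC a).trans (by gcongr)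
  have h3 : K₂ * logSize (a * g) ≤ K₂ * (C * (K₁ * logSize g + logSize g) + logSize g) :=
    mul_le_mul_of_nonneg_left ((logSize_mul_le a g).trans (by linarith)) hK₂
  have h4 := hℓ.mul b a
  linarith

theorem coe_mul_apply (g h : SL(d, ℤ)) (i j : Fin d) :
    (g * h).1 i j = (g.1 *ᵥ fun k => h.1 k j) i := rfl

/-- The entries below the diagonal vanish in the columns before `m`. -/
def LowerCleared (m : ℕ) (g : SL(d, ℤ)) : Prop :=
  ∀ r c : Fin d, (c : ℕ) < m → c < r → g.1 r c = 0

/-- `g` is upper triangular, with zeros above the diagonal in the columns before `m`. -/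
def UpperCleared (m : ℕ) (g : SL(d, ℤ)) : Prop :=
  LowerCleared d g ∧ ∀ r c : Fin d, (c : ℕ) < m → r ≠ c → g.1 r c = 0

theorem diag_sq_eq_one {g : SL(d, ℤ)} (hg : LowerCleared d g) (m : Fin d) :
    g.1 m m * g.1 m m = 1 := by
  have h1 : g.1.det = ∏ i, g.1 i i :=
    Matrix.det_of_isUpperTriangular fun r c hcr => hg r c c.2 hcr
  have h2 : IsUnit (g.1 m m) :=
    isUnit_of_dvd_one ((Finset.dvd_prod_of_mem (fun i => g.1 i i) (Finset.mem_univ m)).trans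
      (h1.symm.trans g.2).dvd)
  rcases Int.isUnit_iff.1 h2 with h | h <;> simp [h]

variable [NeZero d] (hℓ : IsLength ℓ)
    (hL : ∃ C : ℝ, 0 ≤ C ∧ ∀ g, logSize g ≤ C * (ℓ g + 1))
    (hK : ∃ K : ℝ, 0 ≤ K ∧ ∀ (i j : Fin d) (hij : i ≠ j) (n : ℤ),
      ℓ (SpecialLinearGroup.transvection hij n) ≤ K * Real.log (1 + |(n : ℝ)|))

include hℓ hL hK

/-- Entries below the diagonal of column `m` are cleared one row at a time by Euclid's algorithm on
rows `m` and `r`. Both rows vanish in the earlier columns, which therefore do not change. -/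
theorem logReduces_lowerCleared_succ (m : Fin d) :
    LogReduces ℓ (LowerCleared m) (LowerCleared (m + 1)) := by
  have key : ∀ s : ℕ, LogReduces ℓ (LowerCleared m)
      (fun g => LowerCleared m g ∧ ∀ r : Fin d, m < r → (r : ℕ) < s → g.1 r m = 0) := by
    intro s
    induction s with
    | zero => exact LogReduces.of_imp hℓ fun g hg => ⟨hg, by simp⟩
    | succ s ih =>
      refine ih.trans hℓ hL ?_
      by_cases hs : ∃ r : Fin d, (r : ℕ) = s ∧ m < r
      · obtain ⟨r, hr, hmr⟩ := hs
        obtain ⟨K, hK0, hK⟩ := hK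
        refine ⟨4 * K, by positivity, fun g ⟨hg, hg'⟩ => ?_⟩
        obtain ⟨h, hmix, hzero, hle⟩ :=
          exists_mixesOnly_apply_eq_zero hℓ hK0 hK m r hmr.ne fun k => g.1 k m
        refine ⟨h, hle.trans ?_, fun r' c hc hcr => ?_, fun r' hmr' hr' => ?_⟩
        · have h1 := log_entry_le_logSize g m m
          have h2 := log_entry_le_logSize g r m
          have h3 := one_le_logSize g
          calc _ ≤ K * (logSize g + logSize g + 2 * logSize g) := by gcongr; linarith
            _ = _ := by ring
        · have hcm : c < m := hc
          rw [coe_mul_apply, hmix.fixes _ (hg m c hc hcm) (hg r c hc (hcm.trans hmr))]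
          exact hg r' c hc hcr
        · rw [coe_mul_apply]
          rcases eq_or_ne r' r with rfl | hne
          · exact hzero
          · rw [hmix.apply_of_ne _ r' hmr'.ne' hne]
            refine hg' r' hmr' ?_
            have : (r' : ℕ) ≠ s := fun h => hne (Fin.ext (h.trans hr.symm))
            omega
      · refine LogReduces.of_imp hℓ fun g ⟨hg, hg'⟩ => ⟨hg, fun r hmr hr => hg' r hmr ?_⟩
        have : (r : ℕ) ≠ s := fun h => hs ⟨r, h, hmr⟩
        omega
  refine (key d).trans hℓ hL (LogReduces.of_imp hℓ fun g ⟨hg, hg'⟩ r c hc hcr => ?_)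
  rcases Nat.lt_succ_iff_lt_or_eq.1 hc with hc | hc
  · exact hg r c hc hcr
  · obtain rfl : c = m := Fin.ext hc
    exact hg' r hcr r.2

/-- The diagonal entries are ±1, so one transvection clears each entry above the diagonal. Off the
diagonal, row `m` is zero in the columns before `m`, so cleared columns survive. -/
theorem logReduces_upperCleared_succ (m : Fin d) :
    LogReduces ℓ (UpperCleared m) (UpperCleared (m + 1)) := by
  have key : ∀ s : ℕ, LogReduces ℓ (UpperCleared m)
      (fun g => UpperCleared m g ∧ ∀ r : Fin d, r < m → (r : ℕ) < s → g.1 r m = 0) := by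
    intro s
    induction s with
    | zero => exact LogReduces.of_imp hℓ fun g hg => ⟨hg, by simp⟩
    | succ s ih =>
      refine ih.trans hℓ hL ?_
      by_cases hs : ∃ r : Fin d, (r : ℕ) = s ∧ r < m
      · obtain ⟨r, hr, hrm⟩ := hs
        obtain ⟨K, hK0, hK⟩ := hK
        refine ⟨K, hK0, fun g ⟨⟨hg, hg'⟩, hg''⟩ => ?_⟩
        have hsq := diag_sq_eq_one hg m
        set t := SpecialLinearGroup.transvection hrm.ne (-(g.1 r m * g.1 m m)) with ht
        have hmix := mixesOnly_transvection hrm.ne (-(g.1 r m * g.1 m m))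
        rw [← ht] at hmix
        have hentry : ∀ a c, (t * g).1 a c
            = g.1 a c + if a = r then -(g.1 r m * g.1 m m) * g.1 m c else 0 := fun a c => by
          rw [coe_mul_apply, ht, transvection_mulVec_apply]
        refine ⟨t, (hK r m hrm.ne _).trans ?_, ⟨fun a c hc hca => ?_, fun a c hc hac => ?_⟩,
          fun a ham ha => ?_⟩
        · have habs : |((-(g.1 r m * g.1 m m) : ℤ) : ℝ)| = |(g.1 r m : ℝ)| := by
            have : |g.1 m m| = 1 := Int.isUnit_iff_abs_eq.1 (IsUnit.of_mul_eq_one _ hsq)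
            have h2 : |((g.1 m m : ℤ) : ℝ)| = 1 := by exact_mod_cast this
            push_cast
            rw [abs_neg, abs_mul, h2, mul_one]
          rw [habs]
          exact mul_le_mul_of_nonneg_left (log_entry_le_logSize g r m) hK0
        · rw [hentry, hg a c hc hca, zero_add]
          split_ifs with h
          · subst h
            rw [hg m c hc (hca.trans hrm), mul_zero]
          · rfl
        · rw [hentry, hg' a c hc hac, zero_add]
          split_ifs with h
          · rw [hg' m c hc (Fin.ne_of_gt hc), mul_zero]
          · rfl
        · rw [hentry]
          split_ifs with h
          · subst h
            linear_combination (-g.1 a m) * hsq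
          · rw [add_zero]
            refine hg'' a ham ?_
            have : (a : ℕ) ≠ s := fun h' => h (Fin.ext (h'.trans hr.symm))
            omega
      · refine LogReduces.of_imp hℓ fun g ⟨hg, hg'⟩ => ⟨hg, fun r hmr hr => hg' r hmr ?_⟩
        have : (r : ℕ) ≠ s := fun h => hs ⟨r, h, hmr⟩
        omega
  refine (key d).trans hℓ hL (LogReduces.of_imp hℓ fun g ⟨⟨hg, hg'⟩, hg''⟩ => ⟨hg, fun r c hc hrc => ?_⟩)
  rcases Nat.lt_succ_iff_lt_or_eq.1 hc with hc | hc
  · exact hg' r c hc hrc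
  · obtain rfl : c = m := Fin.ext hc
    rcases lt_or_gt_of_ne hrc with h | h
    · exact hg'' r h r.2
    · exact hg r c c.2 h

theorem logReduces_eq_one : LogReduces ℓ (fun _ => True) (fun g => g = 1) := by
  have lower : ∀ m : ℕ, m ≤ d → LogReduces ℓ (fun _ => True) (LowerCleared m) := by
    intro m
    induction m with
    | zero => exact fun _ => LogReduces.of_imp hℓ fun g _ r c hc => absurd hc (by simp)
    | succ m ih =>
      intro hm
      exact (ih (by omega)).trans hℓ hL (logReduces_lowerCleared_succ hℓ hL hK ⟨m, hm⟩)
  have upper : ∀ m : ℕ, m ≤ d → LogReduces ℓ (fun _ => True) (UpperCleared m) := by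
    intro m
    induction m with
    | zero =>
      exact fun _ => (lower d le_rfl).trans hℓ hL
        (LogReduces.of_imp hℓ fun g hg => ⟨hg, fun r c hc => absurd hc (by simp)⟩)
    | succ m ih =>
      intro hm
      exact (ih (by omega)).trans hℓ hL (logReduces_upperCleared_succ hℓ hL hK ⟨m, hm⟩)
  refine (upper d le_rfl).trans hℓ hL ?_
  -- Only diagonal matrices with entries ±1 are left: a finite set, on which `ℓ` is bounded.
  obtain ⟨B, hB⟩ := ((finite_setOf_frobSq_le (d := d) d).image ℓ).bddAbove
  refine ⟨max B 0, le_max_right _ _, fun g ⟨hg, hg'⟩ => ⟨g⁻¹, ?_, inv_mul_cancel g⟩⟩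
  have hfrob : frobSq (toReal g) ≤ d := by
    have : ∀ i, ∑ j, toReal g i j ^ 2 = 1 := fun i => by
      rw [Finset.sum_eq_single i]
      · have h := diag_sq_eq_one hg i
        rw [toReal, Matrix.map_apply, sq]
        exact_mod_cast h
      · intro j _ hj
        simp [toReal, hg' i j j.2 hj.symm]
      · simp
    simp [frobSq, this]
  have h1 : ℓ g ≤ max B 0 := (hB ⟨g, hfrob, rfl⟩).trans (le_max_left _ _)
  have h2 := one_le_logSize g
  rw [hℓ.inv]
  nlinarith [le_max_right B 0]

/-- A length function on `SL(d, ℤ)` that is bounded below by the logarithm of the norm and for which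
elementary matrices have logarithmic length is bounded above by the logarithm of the norm. -/
theorem exists_length_le_logSize : ∃ K : ℝ, 0 ≤ K ∧ ∀ g, ℓ g ≤ K * logSize g := by
  obtain ⟨K, hK0, H⟩ := logReduces_eq_one hℓ hL hK
  refine ⟨K, hK0, fun g => ?_⟩
  obtain ⟨h, hh, h1⟩ := H g trivial
  rwa [eq_inv_of_mul_eq_one_left h1, hℓ.inv] at hh

end Reduction

/-! ### Spectral radius of positive definite matrices -/

section SpectralRadius

variable {d : ℕ}

/-- The Euclidean operator norm. -/
noncomputable def opNorm (M : Matrix (Fin d) (Fin d) ℝ) : ℝ :=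
  ‖Matrix.toEuclideanCLM (n := Fin d) (𝕜 := ℝ) M‖

theorem opNorm_nonneg (M : Matrix (Fin d) (Fin d) ℝ) : 0 ≤ opNorm M := norm_nonneg _

theorem opNorm_mul_le (A B : Matrix (Fin d) (Fin d) ℝ) :
    opNorm (A * B) ≤ opNorm A * opNorm B := by
  unfold opNorm
  rw [map_mul]
  exact norm_mul_le _ _

theorem opNorm_sq_le_frobSq (M : Matrix (Fin d) (Fin d) ℝ) : opNorm M ^ 2 ≤ frobSq M := by
  have h : opNorm M ≤ √(frobSq M) := by
    refine ContinuousLinearMap.opNorm_le_bound _ (Real.sqrt_nonneg _) fun x => ?_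
    refine le_of_pow_le_pow_left₀ two_ne_zero (by positivity) ?_
    rw [mul_pow, Real.sq_sqrt (frobSq_nonneg M), EuclideanSpace.real_norm_sq_eq,
      EuclideanSpace.real_norm_sq_eq, frobSq, Finset.sum_mul]
    refine Finset.sum_le_sum fun i _ => ?_
    exact Finset.sum_mul_sq_le_sq_mul_sq Finset.univ (fun j => M i j) fun j => x j
  calc opNorm M ^ 2 ≤ √(frobSq M) ^ 2 := by gcongr; exact opNorm_nonneg M
    _ = _ := Real.sq_sqrt (frobSq_nonneg M)

theorem prod_eigenvalues_eq_one {Q : Matrix (Fin d) (Fin d) ℝ} (hQ : Q.PosDef) (hdet : Q.det = 1) :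
    ∏ i, hQ.1.eigenvalues i = 1 := by
  rw [← hdet, hQ.1.det_eq_prod_eigenvalues]
  rfl

variable [NeZero d]

theorem spectralRadius_le_opNorm (M : Matrix (Fin d) (Fin d) ℝ) :
    spectralRadius ℝ M ≤ ENNReal.ofReal (opNorm M) := by
  have h := spectrum.spectralRadius_le_nnnorm (𝕜 := ℝ)
    (Matrix.toEuclideanCLM (n := Fin d) (𝕜 := ℝ) M)
  rw [opNorm, ofReal_norm, enorm_eq_nnnorm]
  refine le_trans (le_of_eq ?_) h
  unfold spectralRadius
  rw [AlgEquiv.spectrum_eq (Matrix.toEuclideanCLM (n := Fin d) (𝕜 := ℝ)) M]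

theorem toReal_spectralRadius_le_opNorm (M : Matrix (Fin d) (Fin d) ℝ) :
    (spectralRadius ℝ M).toReal ≤ opNorm M :=
  ENNReal.toReal_le_of_le_ofReal (opNorm_nonneg M) (spectralRadius_le_opNorm M)

variable {Q : Matrix (Fin d) (Fin d) ℝ}

theorem eigenvalues_le_spectralRadius (hQ : Q.PosDef) (i : Fin d) :
    hQ.1.eigenvalues i ≤ (spectralRadius ℝ Q).toReal := by
  have h1 : (‖hQ.1.eigenvalues i‖₊ : ENNReal) ≤ spectralRadius ℝ Q :=
    le_iSup₂ (f := fun k (_ : k ∈ spectrum ℝ Q) => (‖k‖₊ : ENNReal)) _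
      (hQ.1.eigenvalues_mem_spectrum_real i)
  -- Finiteness is needed because `ENNReal.toReal` sends `⊤` to 0.
  have h2 : spectralRadius ℝ Q ≠ ⊤ :=
    ((spectralRadius_le_opNorm Q).trans_lt ENNReal.ofReal_lt_top).ne
  have h3 := ENNReal.toReal_mono h2 h1
  refine (le_abs_self _).trans (le_trans (le_of_eq ?_) h3)
  simp

theorem trace_le_mul_spectralRadius (hQ : Q.PosDef) :
    Q.trace ≤ d * (spectralRadius ℝ Q).toReal := by
  rw [hQ.1.trace_eq_sum_eigenvalues]
  refine (Finset.sum_le_card_nsmul _ _ _ fun i _ => eigenvalues_le_spectralRadius hQ i).trans ?_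
  simp

theorem one_le_spectralRadius (hQ : Q.PosDef) (hdet : Q.det = 1) :
    1 ≤ (spectralRadius ℝ Q).toReal := by
  by_contra! h
  have := Finset.prod_lt_prod (s := Finset.univ) (f := hQ.1.eigenvalues) (g := fun _ => 1)
    (fun i _ => hQ.eigenvalues_pos i)
    (fun i _ => ((eigenvalues_le_spectralRadius hQ i).trans_lt h).le)
    ⟨0, Finset.mem_univ _, (eigenvalues_le_spectralRadius hQ 0).trans_lt h⟩
  rw [prod_eigenvalues_eq_one hQ hdet] at this
  simp at this

/-- Positive eigenvalues that are at most 1 and have product 1 must all equal 1. -/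
theorem eq_one_of_spectralRadius_le_one (hQ : Q.PosDef) (hdet : Q.det = 1)
    (h : (spectralRadius ℝ Q).toReal ≤ 1) : Q = 1 := by
  have hle : ∀ i, hQ.1.eigenvalues i ≤ 1 := fun i => (eigenvalues_le_spectralRadius hQ i).trans h
  have heq : hQ.1.eigenvalues = 1 := by
    funext i
    by_contra hi
    have := Finset.prod_lt_prod (s := Finset.univ) (f := hQ.1.eigenvalues) (g := fun _ => 1)
      (fun i _ => hQ.eigenvalues_pos i) (fun i _ => hle i)
      ⟨i, Finset.mem_univ _, lt_of_le_of_ne (hle i) hi⟩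
    rw [prod_eigenvalues_eq_one hQ hdet] at this
    simp at this
  rw [hQ.1.spectral_theorem, heq]
  have : (RCLike.ofReal ∘ (1 : Fin d → ℝ) : Fin d → ℝ) = 1 := rfl
  rw [this, Matrix.diagonal_one', map_one]

end SpectralRadius

/-! ### The two distances on the symmetric space -/

section Geometry

variable {d : ℕ}

open scoped MatrixOrder in
theorem exists_eq_transpose_mul_self (S : PosDefOne d) :
    ∃ B : Matrix (Fin d) (Fin d) ℝ, IsUnit B.det ∧ S.1 = Bᵀ * B := by
  obtain ⟨B, hB⟩ := CStarAlgebra.nonneg_iff_eq_star_mul_self.mp S.2.1.posSemidef.nonneg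
  have hB' : S.1 = Bᵀ * B := by
    rw [hB, Matrix.star_eq_conjTranspose, Matrix.conjTranspose_eq_transpose_of_trivial]
  refine ⟨B, ?_, hB'⟩
  have h := S.2.2
  rw [hB', Matrix.det_mul] at h
  exact IsUnit.of_mul_eq_one_right _ h

/-- Two points of the space are simultaneously reduced to the identity and a positive definite
matrix. -/
theorem exists_simultaneous (S₁ S₂ : PosDefOne d) :
    ∃ B Q : Matrix (Fin d) (Fin d) ℝ, IsUnit B.det ∧ Q.PosDef ∧ Q.det = 1 ∧
      S₁.1 = Bᵀ * B ∧ S₂.1 = Bᵀ * Q * B ∧ S₁.1⁻¹ * S₂.1 = B⁻¹ * Q * B := by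
  obtain ⟨B, hB, hS⟩ := exists_eq_transpose_mul_self S₁
  have hBt : IsUnit Bᵀ.det := by rwa [Matrix.det_transpose]
  have hBinv : IsUnit B⁻¹ := (Matrix.isUnit_nonsing_inv_iff).2 ((Matrix.isUnit_iff_isUnit_det B).2 hB)
  have hS₂ : S₂.1 = Bᵀ * ((B⁻¹)ᵀ * S₂.1 * B⁻¹) * B := by
    rw [Matrix.transpose_nonsing_inv, ← mul_assoc, ← mul_assoc, Matrix.mul_nonsing_inv _ hBt,
      one_mul, mul_assoc, Matrix.nonsing_inv_mul _ hB, mul_one]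
  refine ⟨B, (B⁻¹)ᵀ * S₂.1 * B⁻¹, hB, ?_, ?_, hS, hS₂, ?_⟩
  · have := S₂.2.1.conjTranspose_mul_mul_same (Matrix.mulVec_injective_of_isUnit hBinv)
    rwa [Matrix.conjTranspose_eq_transpose_of_trivial] at this
  · have h1 := S₁.2.2
    rw [hS, Matrix.det_mul, Matrix.det_transpose] at h1
    have h2 := S₂.2.2
    rw [hS₂, Matrix.det_mul, Matrix.det_mul, Matrix.det_transpose] at h2
    linear_combination h2 - ((B⁻¹)ᵀ * S₂.1 * B⁻¹).det * h1
  · conv_lhs => rw [hS₂, hS, Matrix.mul_inv_rev]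
    rw [mul_assoc, mul_assoc Bᵀ, Matrix.nonsing_inv_mul_cancel_left _ _ hBt, mul_assoc B⁻¹]

theorem spectralRadius_conj {B : Matrix (Fin d) (Fin d) ℝ} (hB : IsUnit B.det)
    (Q : Matrix (Fin d) (Fin d) ℝ) : spectralRadius ℝ (B⁻¹ * Q * B) = spectralRadius ℝ Q := by
  obtain ⟨u, rfl⟩ := (Matrix.isUnit_iff_isUnit_det B).2 hB
  unfold spectralRadius
  rw [← Matrix.coe_units_inv, spectrum.units_conjugate']

theorem trace_conj {B : Matrix (Fin d) (Fin d) ℝ} (hB : IsUnit B.det)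
    (Q : Matrix (Fin d) (Fin d) ℝ) : (B⁻¹ * Q * B).trace = Q.trace := by
  rw [Matrix.trace_mul_comm, ← mul_assoc, Matrix.mul_nonsing_inv _ hB, one_mul]

section NonzeroDimension

variable [NeZero d]

theorem trace_le_mul_spectralRadius_inv_mul (S₁ S₂ : PosDefOne d) :
    (S₁.1⁻¹ * S₂.1).trace ≤ d * (spectralRadius ℝ (S₁.1⁻¹ * S₂.1)).toReal := by
  obtain ⟨B, Q, hB, hQ, -, -, -, h⟩ := exists_simultaneous S₁ S₂
  rw [h, spectralRadius_conj hB, trace_conj hB]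
  exact trace_le_mul_spectralRadius hQ

theorem one_le_spectralRadius_inv_mul (S₁ S₂ : PosDefOne d) :
    1 ≤ (spectralRadius ℝ (S₁.1⁻¹ * S₂.1)).toReal := by
  obtain ⟨B, Q, hB, hQ, hdet, -, -, h⟩ := exists_simultaneous S₁ S₂
  rw [h, spectralRadius_conj hB]
  exact one_le_spectralRadius hQ hdet

theorem eq_of_spectralRadius_inv_mul_le_one {S₁ S₂ : PosDefOne d}
    (h : (spectralRadius ℝ (S₁.1⁻¹ * S₂.1)).toReal ≤ 1) : S₁ = S₂ := by
  obtain ⟨B, Q, hB, hQ, hdet, h₁, h₂, h₃⟩ := exists_simultaneous S₁ S₂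
  rw [h₃, spectralRadius_conj hB] at h
  apply Subtype.ext
  rw [h₁, h₂, eq_one_of_spectralRadius_le_one hQ hdet h, mul_one]

theorem log_spectralRadius_le_invDist (S₁ S₂ : PosDefOne d) :
    Real.log (spectralRadius ℝ (S₁.1⁻¹ * S₂.1)).toReal ≤ invDist S₁ S₂ :=
  le_add_of_nonneg_right (Real.log_nonneg (one_le_spectralRadius_inv_mul S₂ S₁))

theorem invDist_nonneg (S₁ S₂ : PosDefOne d) : 0 ≤ invDist S₁ S₂ :=
  (Real.log_nonneg (one_le_spectralRadius_inv_mul S₁ S₂)).trans (log_spectralRadius_le_invDist _ _)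

theorem invDist_pos {S₁ S₂ : PosDefOne d} (h : S₁ ≠ S₂) : 0 < invDist S₁ S₂ := by
  refine (Real.log_pos ?_).trans_le (log_spectralRadius_le_invDist _ _)
  by_contra! h'
  exact h (eq_of_spectralRadius_inv_mul_le_one h')

theorem invDist_le_normDist (S₁ S₂ : PosDefOne d) : invDist S₁ S₂ ≤ normDist S₁ S₂ :=
  add_le_add
    (Real.log_le_log (zero_lt_one.trans_le (one_le_spectralRadius_inv_mul S₁ S₂))
      (toReal_spectralRadius_le_opNorm _))
    (Real.log_le_log (zero_lt_one.trans_le (one_le_spectralRadius_inv_mul S₂ S₁))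
      (toReal_spectralRadius_le_opNorm _))

theorem one_le_opNorm_inv_mul (S₁ S₂ : PosDefOne d) : 1 ≤ opNorm (S₁.1⁻¹ * S₂.1) :=
  (one_le_spectralRadius_inv_mul S₁ S₂).trans (toReal_spectralRadius_le_opNorm _)

theorem normDist_self (S : PosDefOne d) : normDist S S = 0 := by
  have h : IsUnit S.1.det := by rw [S.2.2]; exact isUnit_one
  simp [normDist, Matrix.nonsing_inv_mul _ h]

end NonzeroDimension

theorem smul_mk_coe (g : SL(d, ℤ)) (S : PosDefOne d) :
    (((g : PSL(d, ℤ)) • S : PosDefOne d)).1 = toReal g * S.1 * (toReal g)ᵀ :=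
  actionPSLInt_mk d g S

theorem isUnit_det_toReal (g : SL(d, ℤ)) : IsUnit (toReal g).det := by
  rw [det_toReal]; exact isUnit_one

/-- The action conjugates `S₁⁻¹ * S₂` by `(toReal g)ᵀ`, which keeps the spectrum. -/
theorem invDist_smul (γ : PSL(d, ℤ)) (S₁ S₂ : PosDefOne d) :
    invDist (γ • S₁) (γ • S₂) = invDist S₁ S₂ := by
  obtain ⟨g, rfl⟩ := QuotientGroup.mk_surjective γ
  have hg := isUnit_det_toReal g
  have hgt : IsUnit (toReal g)ᵀ.det := by rwa [Matrix.det_transpose]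
  have h : ∀ A B : PosDefOne d, spectralRadius ℝ
      ((((g : PSL(d, ℤ)) • A : PosDefOne d)).1⁻¹ * (((g : PSL(d, ℤ)) • B : PosDefOne d)).1)
        = spectralRadius ℝ (A.1⁻¹ * B.1) := fun A B => by
    rw [← spectralRadius_conj hgt (A.1⁻¹ * B.1), smul_mk_coe, smul_mk_coe, Matrix.mul_inv_rev, Matrix.mul_inv_rev]
    congr 1
    simp only [mul_assoc]
    rw [Matrix.nonsing_inv_mul_cancel_left _ _ hg]
  unfold invDist
  rw [h, h]

theorem invDist_smul_smul (γ₁ γ₂ : PSL(d, ℤ)) (S : PosDefOne d) :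
    invDist (γ₁ • S) (γ₂ • S) = invDist S ((γ₁⁻¹ * γ₂) • S) := by
  rw [← invDist_smul γ₁⁻¹, inv_smul_smul, mul_smul]

theorem normDist_smul_le [NeZero d] (S : PosDefOne d) :
    ∃ c : ℝ, 0 ≤ c ∧ ∀ g : SL(d, ℤ), normDist S ((g : PSL(d, ℤ)) • S)
      ≤ c + Real.log (frobSq (toReal g)) + Real.log (frobSq (toReal g⁻¹)) := by
  set N := opNorm S.1⁻¹ * opNorm S.1 with hN
  have hN1 : 1 ≤ N := by
    have h1 : IsUnit S.1.det := by rw [S.2.2]; exact isUnit_one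
    exact (one_le_opNorm_inv_mul S S).trans (opNorm_mul_le _ _)
  refine ⟨2 * Real.log N, by have := Real.log_nonneg hN1; positivity, fun g => ?_⟩
  have hbound : ∀ A M : Matrix (Fin d) (Fin d) ℝ, 0 < frobSq M → 1 ≤ opNorm A →
      opNorm A ≤ N * (opNorm M * opNorm Mᵀ) → Real.log (opNorm A) ≤ Real.log N + Real.log (frobSq M) := by
    intro A M hM hA hAM
    rw [← Real.log_mul (by positivity) hM.ne']
    refine Real.log_le_log (by positivity) (hAM.trans ?_)
    gcongr
    have h1 := opNorm_sq_le_frobSq M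
    have h2 := opNorm_sq_le_frobSq Mᵀ
    rw [frobSq_transpose] at h2
    nlinarith [sq_nonneg (opNorm M - opNorm Mᵀ)]
  have hpos : ∀ h : SL(d, ℤ), 0 < frobSq (toReal h) := fun h =>
    zero_lt_one.trans_le (one_le_frobSq h)
  have hn := opNorm_nonneg (d := d)
  have h1 := hbound _ (toReal g) (hpos g) (one_le_opNorm_inv_mul S ((g : PSL(d, ℤ)) • S)) (by
    rw [smul_mk_coe]
    calc opNorm (S.1⁻¹ * (toReal g * S.1 * (toReal g)ᵀ))
        ≤ opNorm S.1⁻¹ * (opNorm (toReal g) * opNorm S.1 * opNorm (toReal g)ᵀ) := by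
          refine (opNorm_mul_le _ _).trans (mul_le_mul_of_nonneg_left ?_ (hn _))
          refine (opNorm_mul_le _ _).trans (mul_le_mul_of_nonneg_right ?_ (hn _))
          exact opNorm_mul_le _ _
      _ = _ := by rw [hN]; ring)
  have h2 := hbound _ (toReal g⁻¹) (hpos g⁻¹) (one_le_opNorm_inv_mul ((g : PSL(d, ℤ)) • S) S) (by
    rw [smul_mk_coe, Matrix.mul_inv_rev, Matrix.mul_inv_rev, ← Matrix.transpose_nonsing_inv,
      ← toReal_inv]
    calc opNorm ((toReal g⁻¹)ᵀ * (S.1⁻¹ * toReal g⁻¹) * S.1)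
        ≤ opNorm (toReal g⁻¹)ᵀ * (opNorm S.1⁻¹ * opNorm (toReal g⁻¹)) * opNorm S.1 := by
          refine (opNorm_mul_le _ _).trans (mul_le_mul_of_nonneg_right ?_ (hn _))
          refine (opNorm_mul_le _ _).trans (mul_le_mul_of_nonneg_left ?_ (hn _))
          exact opNorm_mul_le _ _
      _ = _ := by rw [hN]; ring)
  unfold normDist
  unfold opNorm at h1 h2
  linarith

/-- With S = BᵀB, the matrix S⁻¹gSgᵀ is conjugate to AAᵀ for A = (Bᵀ)⁻¹gBᵀ, so its trace is the
squared Frobenius norm of a fixed conjugate of `g`. -/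
theorem exists_frobSq_le_mul_trace (S : PosDefOne d) :
    ∃ P : ℝ, 0 < P ∧ ∀ g : SL(d, ℤ),
      frobSq (toReal g) ≤ P * (S.1⁻¹ * ((g : PSL(d, ℤ)) • S : PosDefOne d).1).trace := by
  obtain ⟨B, hB, hS⟩ := exists_eq_transpose_mul_self S
  have hBt : IsUnit Bᵀ.det := by rwa [Matrix.det_transpose]
  have hf := frobSq_nonneg (d := d)
  refine ⟨frobSq Bᵀ * frobSq (Bᵀ)⁻¹ + 1, by have := hf Bᵀ; have := hf (Bᵀ)⁻¹; positivity, fun g => ?_⟩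
  set A := (Bᵀ)⁻¹ * toReal g * Bᵀ with hA
  have htr : (S.1⁻¹ * ((g : PSL(d, ℤ)) • S : PosDefOne d).1).trace = frobSq A := by
    rw [frobSq_eq_trace, smul_mk_coe, hS, Matrix.mul_inv_rev, hA,
      ← trace_conj hB ((Bᵀ)⁻¹ * toReal g * Bᵀ * _)]
    congr 1
    simp only [Matrix.transpose_mul, Matrix.transpose_transpose, Matrix.transpose_nonsing_inv,
      mul_assoc]
    rw [Matrix.nonsing_inv_mul _ hB, mul_one]
  have hg : toReal g = Bᵀ * A * (Bᵀ)⁻¹ := by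
    rw [hA, ← mul_assoc, ← mul_assoc, Matrix.mul_nonsing_inv _ hBt, one_mul, mul_assoc,
      Matrix.mul_nonsing_inv _ hBt, mul_one]
  rw [htr]
  calc frobSq (toReal g) ≤ frobSq Bᵀ * frobSq A * frobSq (Bᵀ)⁻¹ := by
        conv_lhs => rw [hg]
        exact (frobSq_mul_le _ _).trans (mul_le_mul_of_nonneg_right (frobSq_mul_le _ _) (hf _))
    _ ≤ _ := by linarith [hf A]

theorem exists_log_frobSq_le_invDist [NeZero d] (S : PosDefOne d) :
    ∃ c : ℝ, ∀ g : SL(d, ℤ),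
      Real.log (frobSq (toReal g)) ≤ c + invDist S ((g : PSL(d, ℤ)) • S) := by
  obtain ⟨P, hP, H⟩ := exists_frobSq_le_mul_trace S
  have hd : (0 : ℝ) < d := by exact_mod_cast Nat.pos_of_neZero d
  refine ⟨Real.log (P * d), fun g => ?_⟩
  have h1 := one_le_spectralRadius_inv_mul S ((g : PSL(d, ℤ)) • S)
  have h2 := trace_le_mul_spectralRadius_inv_mul S ((g : PSL(d, ℤ)) • S)
  refine le_trans ?_ (add_le_add_right (log_spectralRadius_le_invDist S _) _)
  rw [← Real.log_mul (by positivity) (by positivity)]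
  refine Real.log_le_log (zero_lt_one.trans_le (one_le_frobSq g)) ((H g).trans ?_)
  rw [mul_assoc]
  gcongr

end Geometry

/-! ### Word length against the distances -/

section Size

variable {d : ℕ}

/-- The identity matrix as a point of the space. -/
def onePoint (d : ℕ) : PosDefOne d := ⟨1, Matrix.PosDef.one, Matrix.det_one⟩

/-- The logarithm of the squared Frobenius norm, on `PSL(d, ℤ)`. -/
noncomputable def logFrob (γ : PSL(d, ℤ)) : ℝ :=
  Real.log (γ • onePoint d).1.trace

theorem logFrob_mk (g : SL(d, ℤ)) : logFrob (g : PSL(d, ℤ)) = Real.log (frobSq (toReal g)) := by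
  rw [logFrob, smul_mk_coe, onePoint, mul_one, frobSq_eq_trace]

/-- Word length in PSL, pulled back to SL, is still a length function; the row reduction can thus
run on matrices. -/
theorem isLength_wordLength_mk
    {G : Set PSL(d, ℤ)} (hG : Subgroup.closure G = ⊤) :
    IsLength fun g : SL(d, ℤ) => (wordLength G (g : PSL(d, ℤ)) : ℝ) where
  one := by rw [QuotientGroup.mk_one, wordLength_one, Nat.cast_zero]
  mul g h := by
    rw [QuotientGroup.mk_mul]
    exact_mod_cast wordLength_mul_le hG _ _
  inv g := by rw [QuotientGroup.mk_inv, wordLength_inv hG]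

variable [NeZero d]

theorem logFrob_mul_le (γ δ : PSL(d, ℤ)) : logFrob (γ * δ) ≤ logFrob γ + logFrob δ := by
  obtain ⟨g, rfl⟩ := QuotientGroup.mk_surjective γ
  obtain ⟨h, rfl⟩ := QuotientGroup.mk_surjective δ
  have hg := one_le_frobSq g
  have hh := one_le_frobSq h
  rw [← QuotientGroup.mk_mul, logFrob_mk, logFrob_mk, logFrob_mk,
    ← Real.log_mul (by positivity) (by positivity)]
  refine Real.log_le_log (zero_lt_one.trans_le (one_le_frobSq _)) ?_
  rw [toReal_mul]
  exact frobSq_mul_le _ _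

variable {G : Set PSL(d, ℤ)} (hG : Subgroup.closure G = ⊤) (hfin : G.Finite)

include hG hfin

theorem exists_logFrob_le_wordLength :
    ∃ C : ℝ, 0 ≤ C ∧ ∀ γ : PSL(d, ℤ), logFrob γ ≤ C * (wordLength G γ + 1) := by
  obtain ⟨C, hC, H⟩ := exists_le_mul_wordLength hG hfin logFrob fun s =>
    ⟨logFrob s, fun g => (logFrob_mul_le s g).trans_eq (add_comm _ _)⟩
  refine ⟨C + |logFrob (1 : PSL(d, ℤ))|, by positivity, fun γ => (H γ).trans ?_⟩
  have h1 := le_abs_self (logFrob (1 : PSL(d, ℤ)))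
  have h2 : 0 ≤ |logFrob (1 : PSL(d, ℤ))| * wordLength G γ := by positivity
  linarith

/-- Additive constants cost nothing: both sides vanish at 1, and elsewhere the word length is at
least 1. -/
theorem exists_normDist_le_wordLength (S : PosDefOne d) :
    ∃ C : ℝ, 0 < C ∧ ∀ γ : PSL(d, ℤ), normDist S (γ • S) ≤ C * wordLength G γ := by
  obtain ⟨C, hC, H⟩ := exists_logFrob_le_wordLength hG hfin
  obtain ⟨c, hc, H'⟩ := normDist_smul_le S
  refine ⟨c + 4 * C + 1, by positivity, fun γ => ?_⟩
  rcases eq_or_ne γ 1 with rfl | hγ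
  · simp [normDist_self, wordLength_one]
  have h1 : (1 : ℝ) ≤ wordLength G γ := by exact_mod_cast one_le_wordLength hG hγ
  have h2 := H γ
  have h3 := H γ⁻¹
  rw [wordLength_inv hG] at h3
  obtain ⟨g, rfl⟩ := QuotientGroup.mk_surjective γ
  have h4 := H' g
  rw [← QuotientGroup.mk_inv] at h3
  rw [logFrob_mk] at h2 h3
  refine h4.trans ?_
  have h5 : c ≤ c * wordLength G (g : PSL(d, ℤ)) := le_mul_of_one_le_right hc h1
  have h6 : C ≤ C * wordLength G (g : PSL(d, ℤ)) := le_mul_of_one_le_right hC h1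
  linarith

theorem exists_wordLength_le_logSize (hd : 3 ≤ d) :
    ∃ K : ℝ, 0 ≤ K ∧ ∀ g : SL(d, ℤ), (wordLength G (g : PSL(d, ℤ)) : ℝ) ≤ K * logSize g := by
  have hℓ := isLength_wordLength_mk hG
  refine exists_length_le_logSize hℓ ?_ (exists_transvection_length_le hℓ hd)
  obtain ⟨C, hC, H⟩ := exists_logFrob_le_wordLength hG hfin
  refine ⟨C + 1, by positivity, fun g => ?_⟩
  have h := H g
  rw [logFrob_mk] at h
  have : (0 : ℝ) ≤ wordLength G (g : PSL(d, ℤ)) := Nat.cast_nonneg _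
  unfold logSize
  linarith

omit hG hfin in
/-- Non-trivial elements move a point with trivial stabiliser by a distance bounded below. -/
theorem exists_one_le_mul_invDist {S : PosDefOne d} (hS : MulAction.stabilizer PSL(d, ℤ) S = ⊥) :
    ∃ B : ℝ, 1 ≤ B ∧ ∀ γ : PSL(d, ℤ), γ ≠ 1 → 1 ≤ B * invDist S (γ • S) := by
  obtain ⟨c, hc⟩ := exists_log_frobSq_le_invDist S
  have hfin : {γ : PSL(d, ℤ) | invDist S (γ • S) ≤ 1}.Finite := by
    refine ((finite_setOf_frobSq_le (d := d) (Real.exp (c + 1))).image QuotientGroup.mk).subset ?_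
    intro γ hγ
    obtain ⟨g, rfl⟩ := QuotientGroup.mk_surjective γ
    refine ⟨g, ?_, rfl⟩
    have h1 := one_le_frobSq g
    exact (Real.log_le_iff_le_exp (by positivity)).1 ((hc g).trans (add_le_add_right hγ c))
  -- Only finitely many orbit translations move `S` by at most 1, so their inverse distances are
  -- bounded.
  obtain ⟨B, hB⟩ := (hfin.image fun γ => (invDist S (γ • S))⁻¹).bddAbove
  refine ⟨max B 1, le_max_right _ _, fun γ hγ => ?_⟩
  have hpos : 0 < invDist S (γ • S) := invDist_pos fun h => hγ (by
    rw [← Subgroup.mem_bot, ← hS]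
    exact h.symm)
  rcases le_total (invDist S (γ • S)) 1 with h | h
  · rw [← div_le_iff₀ hpos, one_div]
    exact (hB ⟨γ, h, rfl⟩).trans (le_max_left _ _)
  · exact one_le_mul_of_one_le_of_one_le (le_max_right _ _) h

/-- `logSize` is at most `invDist` plus a constant, and for γ ≠ 1 the constant is a multiple of
`invDist` by `exists_one_le_mul_invDist`. -/
theorem exists_wordLength_le_invDist (hd : 3 ≤ d) {S : PosDefOne d}
    (hS : MulAction.stabilizer PSL(d, ℤ) S = ⊥) :
    ∃ C : ℝ, 0 < C ∧ ∀ γ : PSL(d, ℤ), (wordLength G γ : ℝ) ≤ C * invDist S (γ • S) := by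
  obtain ⟨K, hK, H⟩ := exists_wordLength_le_logSize hG hfin hd
  obtain ⟨c, hc⟩ := exists_log_frobSq_le_invDist S
  obtain ⟨B, hB1, hB⟩ := exists_one_le_mul_invDist hS
  refine ⟨K * |1 + c| * B + K + 1, by positivity, fun γ => ?_⟩
  have hnn := invDist_nonneg S (γ • S)
  rcases eq_or_ne γ 1 with rfl | hγ
  · rw [wordLength_one, Nat.cast_zero]
    positivity
  have h1 := hB γ hγ
  obtain ⟨g, rfl⟩ := QuotientGroup.mk_surjective γ
  have h2 : logSize g ≤ |1 + c| + invDist S ((g : PSL(d, ℤ)) • S) := by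
    unfold logSize
    linarith [hc g, le_abs_self (1 + c)]
  calc (wordLength G (g : PSL(d, ℤ)) : ℝ) ≤ K * logSize g := H g
    _ ≤ K * (|1 + c| * 1 + invDist S ((g : PSL(d, ℤ)) • S)) := by gcongr; linarith
    _ ≤ K * (|1 + c| * (B * invDist S ((g : PSL(d, ℤ)) • S))
          + invDist S ((g : PSL(d, ℤ)) • S)) := by gcongr
    _ ≤ _ := by linarith

end Size

/-! ### Euclidean depth and linear growth in PSL(2, ℤ) -/

section RankOne

/-- The number of steps of the subtractive Euclidean algorithm. -/
def euclidDepth : ℕ → ℕ → ℕ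
  | 0, _ => 0
  | _ + 1, 0 => 0
  | p + 1, q + 1 => if p < q then 1 + euclidDepth (p + 1) (q - p) else 1 + euclidDepth (p - q) (q + 1)
termination_by p q => p + q

theorem euclidDepth_zero_left (q : ℕ) : euclidDepth 0 q = 0 := by rw [euclidDepth]

theorem euclidDepth_zero_right (p : ℕ) : euclidDepth p 0 = 0 := by
  cases p <;> rw [euclidDepth]

theorem euclidDepth_add_left (p : ℕ) {q : ℕ} (hq : 0 < q) :
    euclidDepth (p + q) q = 1 + euclidDepth p q := by
  obtain ⟨q, rfl⟩ := Nat.exists_eq_succ_of_ne_zero hq.ne'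
  rw [Nat.succ_eq_add_one, ← add_assoc, euclidDepth, if_neg (by omega), Nat.add_sub_cancel]

theorem euclidDepth_add_right {p : ℕ} (hp : 0 < p) (q : ℕ) :
    euclidDepth p (p + q) = 1 + euclidDepth p q := by
  obtain ⟨p, rfl⟩ := Nat.exists_eq_succ_of_ne_zero hp.ne'
  rcases Nat.eq_zero_or_pos q with rfl | hq
  · have h := euclidDepth_add_left 0 hp
    rw [zero_add, euclidDepth_zero_left] at h
    rw [add_zero, h, euclidDepth_zero_right]
  · rw [Nat.succ_eq_add_one, add_right_comm, euclidDepth, if_pos (by omega), Nat.add_sub_cancel_left]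

theorem euclidDepth_comm (p q : ℕ) : euclidDepth p q = euclidDepth q p := by
  induction hn : p + q using Nat.strong_induction_on generalizing p q with
  | _ n ih =>
    rcases Nat.eq_zero_or_pos p with rfl | hp
    · rw [euclidDepth_zero_left, euclidDepth_zero_right]
    rcases Nat.eq_zero_or_pos q with rfl | hq
    · rw [euclidDepth_zero_left, euclidDepth_zero_right]
    rcases le_total p q with h | h
    · obtain ⟨r, rfl⟩ := Nat.exists_eq_add_of_le h
      rw [euclidDepth_add_right hp, add_comm p r, euclidDepth_add_left _ hp,
        ih _ (by omega) p r rfl]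
    · obtain ⟨r, rfl⟩ := Nat.exists_eq_add_of_le h
      rw [euclidDepth_add_right hq, add_comm q r, euclidDepth_add_left _ hq,
        ih _ (by omega) r q rfl]

theorem euclidDepth_add_le (p q : ℕ) :
    euclidDepth (p + q) q ≤ euclidDepth p q + 1 ∧ euclidDepth p q ≤ euclidDepth (p + q) q + 1 := by
  rcases Nat.eq_zero_or_pos q with rfl | hq
  · simp [euclidDepth_zero_right]
  · rw [euclidDepth_add_left p hq]; omega

theorem euclidDepth_sub_le (p r : ℕ) :
    euclidDepth r (p + r) ≤ euclidDepth p (p + r) + 1 := by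
  rcases Nat.eq_zero_or_pos r with rfl | hr
  · simp [euclidDepth_zero_left]
  rcases Nat.eq_zero_or_pos p with rfl | hp
  · have h := euclidDepth_add_left 0 hr
    rw [zero_add, euclidDepth_zero_left] at h
    rw [zero_add, h, euclidDepth_zero_left]
  · rw [euclidDepth_add_right hp, add_comm, euclidDepth_add_right hr, euclidDepth_comm]
    omega

/-- Among |b|, |e| and |b + e| one is the sum of the other two, so the signed addition is one step
of the algorithm, forwards, backwards or up to symmetry. -/
theorem euclidDepth_natAbs_add_le (b e : ℤ) :
    euclidDepth (b + e).natAbs e.natAbs ≤ euclidDepth b.natAbs e.natAbs + 1 := by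
  have h : (b + e).natAbs = b.natAbs + e.natAbs ∨ b.natAbs = (b + e).natAbs + e.natAbs ∨
      e.natAbs = b.natAbs + (b + e).natAbs := by omega
  rcases h with h | h | h
  · rw [h]
    exact (euclidDepth_add_le _ _).1
  · rw [h]
    exact (euclidDepth_add_le _ _).2
  · rw [h]
    exact euclidDepth_sub_le _ _

theorem euclidDepth_self_one (n : ℕ) : euclidDepth n 1 = n := by
  induction n with
  | zero => exact euclidDepth_zero_left 1
  | succ n ih => rw [euclidDepth_add_left n one_pos, ih, add_comm]

/-- The Euclidean depth of the second column of a matrix. -/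
def columnDepth (g : SL(2, ℤ)) : ℕ := euclidDepth (g.1 0 1).natAbs (g.1 1 1).natAbs

theorem columnDepth_S_mul (g : SL(2, ℤ)) : columnDepth (ModularGroup.S * g) = columnDepth g := by
  unfold columnDepth
  rw [euclidDepth_comm]
  simp [ModularGroup.coe_S, Matrix.mul_apply, Fin.sum_univ_two]

theorem columnDepth_T_mul (g : SL(2, ℤ)) :
    columnDepth (ModularGroup.T * g)
      = euclidDepth (g.1 0 1 + g.1 1 1).natAbs (g.1 1 1).natAbs := by
  simp [columnDepth, ModularGroup.coe_T, Matrix.mul_apply, Fin.sum_univ_two]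

/-- Left multiplication by a fixed element changes the depth by a bounded amount. -/
theorem exists_abs_columnDepth_mul_sub_le (s : SL(2, ℤ)) :
    ∃ C : ℝ, ∀ g, |(columnDepth (s * g) : ℝ) - columnDepth g| ≤ C := by
  have hs : s ∈ Subgroup.closure {ModularGroup.S, ModularGroup.T} := by
    rw [SpecialLinearGroup.SL2Z_generators]; trivial
  induction hs using Subgroup.closure_induction with
  | mem x hx =>
    rcases hx with rfl | rfl
    · exact ⟨0, fun g => by simp [columnDepth_S_mul]⟩
    · refine ⟨1, fun g => ?_⟩
      have h1 := euclidDepth_natAbs_add_le (g.1 0 1) (g.1 1 1)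
      -- Undoing the addition gives the opposite inequality.
      have h2 := euclidDepth_natAbs_add_le (g.1 0 1 + g.1 1 1) (-g.1 1 1)
      rw [add_neg_cancel_right, Int.natAbs_neg] at h2
      rw [columnDepth_T_mul, columnDepth, abs_le]
      constructor
      · rify at h2; linarith
      · rify at h1; linarith
  | one => exact ⟨0, by simp⟩
  | mul x y _ _ hx hy =>
    obtain ⟨C, hC⟩ := hx
    obtain ⟨D, hD⟩ := hy
    refine ⟨C + D, fun g => ?_⟩
    rw [mul_assoc]
    exact (abs_sub_le _ _ _).trans (add_le_add (hC (y * g)) (hD g))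
  | inv x _ hx =>
    obtain ⟨C, hC⟩ := hx
    refine ⟨C, fun g => ?_⟩
    simpa [abs_sub_comm] using hC (x⁻¹ * g)

/-- Representatives differ by a sign, which absolute values ignore; the depth descends to PSL(2, ℤ).
-/
theorem columnDepth_out_mk (g : SL(2, ℤ)) : columnDepth (g : PSL(2, ℤ)).out = columnDepth g := by
  obtain ⟨z, hz⟩ := QuotientGroup.mk_out_eq_mul (Subgroup.center SL(2, ℤ)) g
  obtain ⟨r, hr, hrz⟩ := Matrix.SpecialLinearGroup.mem_center_iff.1 z.2
  have hu : r.natAbs = 1 := Int.isUnit_iff_natAbs_eq.1 (IsUnit.of_pow_eq_one hr (by simp))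
  have hentry : ∀ i j, (g * z.1).1 i j = g.1 i j * r := fun i j => by
    change (g.1 * z.1.1) i j = _
    rw [← hrz, Matrix.scalar_apply, Matrix.mul_diagonal]
  refine (congrArg columnDepth hz).trans ?_
  unfold columnDepth
  rw [hentry, hentry, Int.natAbs_mul, Int.natAbs_mul, hu, mul_one, mul_one]

theorem unipotent_pow (n : ℕ) :
    unipotent ^ n = ((ModularGroup.T ^ n : SL(2, ℤ)) : PSL(2, ℤ)) := rfl

theorem coe_T_pow (n : ℕ) : (ModularGroup.T ^ n).1 = !![1, (n : ℤ); 0, 1] := by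
  rw [← zpow_natCast, ModularGroup.coe_T_zpow]

theorem coe_T_pow_inv (n : ℕ) : ((ModularGroup.T ^ n)⁻¹).1 = !![1, -(n : ℤ); 0, 1] := by
  rw [← zpow_natCast, ← _root_.zpow_neg, ModularGroup.coe_T_zpow]

theorem frobSq_toReal_T_pow (n : ℕ) :
    frobSq (toReal (ModularGroup.T ^ n)) = n ^ 2 + 2 ∧
      frobSq (toReal (ModularGroup.T ^ n)⁻¹) = n ^ 2 + 2 := by
  constructor
  · rw [toReal, coe_T_pow]
    simp [frobSq, Fin.sum_univ_two]
    ring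
  · rw [toReal, coe_T_pow_inv]
    simp [frobSq, Fin.sum_univ_two]
    ring

variable {G : Set PSL(2, ℤ)}

/-- The unipotent element generates an undistorted subgroup of `PSL(2, ℤ)`. -/
theorem exists_mul_le_wordDist_unipotent (hG : Subgroup.closure G = ⊤) (hfin : G.Finite) :
    ∃ a : ℝ, 0 < a ∧ ∀ n : ℕ, a * n ≤ wordDist G 1 (unipotent ^ n) := by
  obtain ⟨C, hC, H⟩ := exists_le_mul_wordLength hG hfin
    (fun γ => (columnDepth γ.out : ℝ)) fun s => by
      obtain ⟨s, rfl⟩ := QuotientGroup.mk_surjective s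
      obtain ⟨C, hC⟩ := exists_abs_columnDepth_mul_sub_le s
      refine ⟨C, fun γ => ?_⟩
      obtain ⟨g, rfl⟩ := QuotientGroup.mk_surjective γ
      rw [← QuotientGroup.mk_mul, columnDepth_out_mk, columnDepth_out_mk]
      linarith [(abs_le.1 (hC g)).2]
  refine ⟨(C + 1)⁻¹, by positivity, fun n => ?_⟩
  have h := H (unipotent ^ n)
  have h1 : columnDepth (1 : PSL(2, ℤ)).out = 0 := by
    rw [← QuotientGroup.mk_one, columnDepth_out_mk]
    simp [columnDepth, euclidDepth_zero_left]
  have h2 : columnDepth (unipotent ^ n).out = n := by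
    rw [unipotent_pow, columnDepth_out_mk, columnDepth, coe_T_pow]
    simp [euclidDepth_self_one]
  rw [h1, h2] at h
  rw [wordDist, inv_one, one_mul, inv_mul_le_iff₀ (by positivity)]
  have : (0 : ℝ) ≤ wordLength G (unipotent ^ n) := Nat.cast_nonneg _
  push_cast at h
  linarith

theorem wordDist_unipotent_le (hG : Subgroup.closure G = ⊤) (n : ℕ) :
    wordDist G 1 (unipotent ^ n) ≤ (wordLength G unipotent + 1) * n := by
  rw [wordDist, inv_one, one_mul]
  have h : (wordLength G (unipotent ^ n) : ℝ) ≤ n * wordLength G unipotent := by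
    exact_mod_cast wordLength_pow_le hG unipotent n
  have : (0 : ℝ) ≤ n := Nat.cast_nonneg n
  linarith

theorem exists_normDist_unipotent_le (S : PosDefOne 2) :
    ∃ C : ℝ, ∀ n : ℕ, 2 ≤ n → normDist S ((unipotent ^ n) • S) ≤ C * Real.log n := by
  obtain ⟨c, hc, H⟩ := normDist_smul_le S
  have hlog2 : 0 < Real.log 2 := Real.log_pos one_lt_two
  -- For `n ≥ 2`, n² + 2 ≤ n³ holds, so `u ^ n` and its inverse contribute 3 log n each; log n ≥ log
  -- 2 absorbs `c`.
  refine ⟨c / Real.log 2 + 6, fun n hn => ?_⟩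
  have hn' : (2 : ℝ) ≤ n := by exact_mod_cast hn
  have h := H (ModularGroup.T ^ n)
  rw [← unipotent_pow, (frobSq_toReal_T_pow n).1, (frobSq_toReal_T_pow n).2] at h
  have h1 : Real.log ((n : ℝ) ^ 2 + 2) ≤ 3 * Real.log n := by
    have : (3 : ℝ) * Real.log n = Real.log ((n : ℝ) ^ 3) := by rw [Real.log_pow]; norm_num
    rw [this]
    apply Real.log_le_log (by positivity)
    nlinarith
  have h2 : c ≤ c / Real.log 2 * Real.log n := by
    rw [div_mul_eq_mul_div, le_div_iff₀ hlog2]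
    gcongr
  linarith

theorem isBigO_log_of_le_normDist {S : PosDefOne 2} {D : PosDefOne 2 → PosDefOne 2 → ℝ}
    (h₀ : ∀ A B, 0 ≤ D A B) (h₁ : ∀ A B, D A B ≤ normDist A B) :
    (fun n : ℕ => geomDist D S 1 (unipotent ^ n)) =O[Filter.atTop] fun n : ℕ => Real.log n := by
  obtain ⟨C, hC⟩ := exists_normDist_unipotent_le S
  refine Asymptotics.IsBigO.of_bound C (Filter.eventually_atTop.2 ⟨2, fun n hn => ?_⟩)
  rw [geomDist, one_smul, Real.norm_of_nonneg (h₀ _ _),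
    Real.norm_of_nonneg (Real.log_natCast_nonneg n)]
  exact (h₁ _ _).trans (hC n hn)

theorem not_lipschitzEquiv_of_isBigO_log {D : PSL(2, ℤ) → PSL(2, ℤ) → ℝ}
    (hG : Subgroup.closure G = ⊤) (hfin : G.Finite)
    (hD : (fun n : ℕ => D 1 (unipotent ^ n)) =O[Filter.atTop] fun n : ℕ => Real.log n) :
    ¬ LipschitzEquiv D (wordDist G) := by
  rintro ⟨_, C, _, hC, H⟩
  obtain ⟨a, ha, Ha⟩ := exists_mul_le_wordDist_unipotent hG hfin
  have h1 : (fun n : ℕ => (n : ℝ)) =O[Filter.atTop] fun n : ℕ => D 1 (unipotent ^ n) := by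
    refine Asymptotics.IsBigO.of_bound (C / a) (Filter.Eventually.of_forall fun n => ?_)
    rw [Real.norm_of_nonneg (Nat.cast_nonneg n), div_mul_eq_mul_div, le_div_iff₀' ha]
    exact ((Ha n).trans (H 1 (unipotent ^ n)).2).trans
      (mul_le_mul_of_nonneg_left (le_abs_self _) hC.le)
  have h2 : (fun n : ℕ => Real.log n) =o[Filter.atTop] fun n : ℕ => (n : ℝ) :=
    Real.isLittleO_log_id_atTop.comp_tendsto tendsto_natCast_atTop_atTop
  refine Asymptotics.isLittleO_irrefl ?_ ((h1.trans hD).trans_isLittleO h2)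
  exact (Filter.eventually_atTop.2 ⟨1, fun n hn => by
    have : n ≠ 0 := by omega
    exact_mod_cast this⟩).frequently

end RankOne

end PSLDistance

theorem theorem4p1 :
    (∀ S₀ : PSLDistance.PosDefOne 2, MulAction.stabilizer PSL(2, ℤ) S₀ = ⊥ →
      ∀ G : Finset PSL(2, ℤ), Subgroup.closure (G : Set PSL(2, ℤ)) = ⊤ →
        (∃ a b : ℝ, 0 < a ∧ 0 < b ∧ ∀ n : ℕ,
          a * n ≤ PSLDistance.wordDist (G : Set PSL(2, ℤ)) 1 (PSLDistance.unipotent ^ n) ∧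
          PSLDistance.wordDist (G : Set PSL(2, ℤ)) 1 (PSLDistance.unipotent ^ n) ≤ b * n) ∧
        ((fun n : ℕ => PSLDistance.geomDist PSLDistance.invDist S₀ 1 (PSLDistance.unipotent ^ n))
          =O[Filter.atTop] fun n : ℕ => Real.log n) ∧
        ¬ PSLDistance.LipschitzEquiv (PSLDistance.geomDist PSLDistance.invDist S₀)
          (PSLDistance.wordDist (G : Set PSL(2, ℤ))) ∧
        ((fun n : ℕ => PSLDistance.geomDist PSLDistance.normDist S₀ 1 (PSLDistance.unipotent ^ n))
          =O[Filter.atTop] fun n : ℕ => Real.log n) ∧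
        ¬ PSLDistance.LipschitzEquiv (PSLDistance.geomDist PSLDistance.normDist S₀)
          (PSLDistance.wordDist (G : Set PSL(2, ℤ)))) ∧
    (∀ d : ℕ, 3 ≤ d →
      ∀ S₀ : PSLDistance.PosDefOne d, MulAction.stabilizer PSL(d, ℤ) S₀ = ⊥ →
      ∀ G : Finset PSL(d, ℤ), Subgroup.closure (G : Set PSL(d, ℤ)) = ⊤ →
        PSLDistance.LipschitzEquiv (PSLDistance.geomDist PSLDistance.invDist S₀)
          (PSLDistance.wordDist (G : Set PSL(d, ℤ))) ∧
        ∃ c C : ℝ, 0 < c ∧ 0 < C ∧ ∀ γ : PSL(d, ℤ),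
          c * PSLDistance.geomDist PSLDistance.normDist S₀ 1 γ
            ≤ PSLDistance.wordDist (G : Set PSL(d, ℤ)) 1 γ ∧
          PSLDistance.wordDist (G : Set PSL(d, ℤ)) 1 γ
            ≤ C * PSLDistance.geomDist PSLDistance.normDist S₀ 1 γ) := by
  open PSLDistance in
  refine ⟨fun S₀ _ G hG => ?_, fun d hd S₀ hS G hG => ?_⟩
  · have hfin := G.finite_toSet
    have hn : ∀ A B : PosDefOne 2, 0 ≤ normDist A B := fun A B =>
      (invDist_nonneg A B).trans (invDist_le_normDist A B)
    have h₁ := isBigO_log_of_le_normDist (S := S₀) invDist_nonneg invDist_le_normDist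
    have h₂ := isBigO_log_of_le_normDist (S := S₀) hn fun _ _ => le_rfl
    obtain ⟨a, ha, Ha⟩ := exists_mul_le_wordDist_unipotent hG hfin
    exact ⟨⟨a, _, ha, by positivity, fun n => ⟨Ha n, wordDist_unipotent_le hG n⟩⟩,
      h₁, not_lipschitzEquiv_of_isBigO_log hG hfin h₁,
      h₂, not_lipschitzEquiv_of_isBigO_log hG hfin h₂⟩
  · have : NeZero d := ⟨by omega⟩
    obtain ⟨C₁, hC₁, H₁⟩ := exists_normDist_le_wordLength hG G.finite_toSet S₀
    obtain ⟨C₂, hC₂, H₂⟩ := exists_wordLength_le_invDist hG G.finite_toSet hd hS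
    -- The same constants serve both distances, since `invDist ≤ normDist`: the upper bound is
    -- proved for the larger and the lower bound for the smaller.
    refine ⟨⟨C₁⁻¹, C₂, by positivity, hC₂, fun x y => ?_⟩, C₁⁻¹, C₂, by positivity, hC₂, fun γ => ?_⟩
    · rw [geomDist, invDist_smul_smul, inv_mul_le_iff₀ hC₁]
      exact ⟨(invDist_le_normDist _ _).trans (H₁ _), H₂ _⟩
    · rw [geomDist, one_smul, inv_mul_le_iff₀ hC₁, wordDist, inv_one, one_mul]
      exact ⟨H₁ γ, (H₂ γ).trans (mul_le_mul_of_nonneg_left (invDist_le_normDist _ _) hC₂.le)⟩
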